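/- Let $M=2^\lambda$ with $\lambda\ge 3$, let $\mathcal S=\{x_m=e^{j(2m-1)\pi/M}:1\le m\le M\}$ be the $M$-PSK signal set, and let $k,l\in\{1,\dots,M/2\}$ with $k\ne M/2$, $l\neq M/2$. For $s\in\mathbb C$, a singularity removal constraint for $s$ is a nonempty set of the form $\{(a,b)\in\{1,\dots,M\}^2: x_a+s x_b=z\}$, $z\in\mathbb C$. The vital graph $\mathcal G^V_s$ has as vertices the singularity removal constraints with at least two cells; two distinct vertices are adjacent iff they contain cells lying in a common row or a common column. A proper colouring of $\mathcal G^V_s$ with colours $1,\dots,8$ defines a partially filled $M\times M$ square: each cell of a vertex is filled with the colour of that vertex, and all other cells are empty. Consider one of the following two cases. (i) $s=\frac{\sin(\pi k/M)}{\sin(\pi l/M)}$ with $k=2^{m_1}a_1$, $l=2^{m_2}a_2$, $a_1,a_2$ odd, $1\le m_1<m_2$. Put $\varepsilon=0$. (ii) $s=\frac{\sin(\pi k/M)}{\sin(\pi l/M)}e^{j\pi/M}$, where one of $k,l$ is odd and the other is $2^m a$ with $a$ odd and $m\ge1$. Put $\varepsilon=1$. In both cases the vertices of $\mathcal G^V_s$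 are the following $2M$ pairwise distinct sets ($0\le i\le M-1$; row and column indices are reduced modulo $M$ to $\{1,\dots,M\}$): $$c_{i+1}=\left\{\left(i+1,\ i-\tfrac M2-\tfrac{k+\varepsilon-l}2+1\right),\ \left(i-k+1,\ i+\tfrac M2-\tfrac{k+\varepsilon+l}2+1\right)\right\},$$ $$c_{M+i+1}=\left\{\left(i+1,\ i-\tfrac{k+\varepsilon+l}2+1\right),\ \left(i-k+1,\ i-\tfrac{k+\varepsilon-l}2+1\right)\right\}.$$ Moreover, giving colours $1,\dots,8$ to the vertices $c_v$ with $v$ in the following sets $S_1,\dots,S_8$, respectively, is a proper colouring of $\mathcal G_s^V$, and the resulting partially filled square can be completed to an $M\times M$ Latin square with the $M$ symbols $1,\dots,M$ (every cell filled, no symbol repeated in any row or column, filled cells unchanged). In case (i), for $i,j\ge 1$ let $U_{i,j}=\{(j-1)2^{m_2+1}+(i-1)2^{m_1}+u:1\le u\le 2^{m_1}\}$. Then $S_1,S_2,S_3,S_4$ are the unions of the $U_{i,j}$ over $1\le j\le 2^{\lambda-m_2-1}$ and, respectively, $i$ odd in $[1,2^{m_2-m_1}]$; $i$ even in $[1,2^{m_2-m_1}]$;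 $i$ odd in $[2^{m_2-m_1}+1,2^{m_2-m_1+1}]$; $i$ even in $[2^{m_2-m_1}+1,2^{m_2-m_1+1}]$. Further $S_{q+4}=M+S_q$ for $1\le q\le4$. In case (ii), for $1\le i\le 2^{\lambda-m}$ let $U^{odd}_i=\{(i-1)2^m+u:1\le u\le 2^m,\ u\text{ odd}\}$ and $U^{even}_i=\{(i-1)2^m+u:1\le u\le 2^m,\ u\text{ even}\}$. Then $S_1=\bigcup_{i\text{ odd}}U_i^{odd}$, $S_2=\bigcup_{i\text{ even}}U_i^{odd}$, $S_3=\bigcup_{i\text{ odd}}U_i^{even}$, $S_4=\bigcup_{i\text{ even}}U_i^{even}$, and $S_{q+4}=M+S_q$ for $1\le q\le 4$. -/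

import Mathlib

/-! A labelled signal set is a map `x : ι → ℂ`; the cell `(a, b)` of an `ι × ι` square stands for
the pair of transmitted points `(x a, x b)`. Symbols of squares are positive natural numbers. -/

/-- A (nonempty) singularity removal constraint for the fade state `s`. -/
def IsConstraint {ι : Type*} (x : ι → ℂ) (s : ℂ) (c : Finset (ι × ι)) : Prop :=
  c.Nonempty ∧
  (∀ p ∈ c, ∀ p' ∈ c, x p.1 + s * x p.2 = x p'.1 + s * x p'.2) ∧
  (∀ p ∈ c, ∀ p' ∉ c, x p.1 + s * x p.2 ≠ x p'.1 + s * x p'.2)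

/-- The singularity removal graph. -/
def removalGraph {ι : Type*} (x : ι → ℂ) (s : ℂ) :
    SimpleGraph {c : Finset (ι × ι) // IsConstraint x s c} where
  Adj c d := c ≠ d ∧ ∃ p ∈ c.1, ∃ p' ∈ d.1, p.1 = p'.1 ∨ p.2 = p'.2
  symm := ⟨by
    rintro c d ⟨hne, p, hp, p', hp', h⟩
    exact ⟨hne.symm, p', hp', p, hp, h.imp Eq.symm Eq.symm⟩⟩
  loopless := ⟨fun c h => h.1 rfl⟩

/-- The vital subgraph: the subgraph induced by the constraints with at least two cells. -/
def vitalGraph {ι : Type*} (x : ι → ℂ) (s : ℂ) :=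
  (removalGraph x s).induce {c | 2 ≤ c.1.card}

open Classical in
/-- The singularity removal constraint that contains the cell `p`. -/
noncomputable def constraintOf {ι : Type*} [Fintype ι] (x : ι → ℂ) (s : ℂ) (p : ι × ι) :
    {c : Finset (ι × ι) // IsConstraint x s c} :=
  ⟨Finset.univ.filter fun p' => x p'.1 + s * x p'.2 = x p.1 + s * x p.2, by
    refine ⟨⟨p, by simp⟩, ?_, ?_⟩
    · intro q hq q' hq'
      simp only [Finset.mem_filter, Finset.mem_univ, true_and] at hq hq'
      rw [hq, hq']
    · intro q hq q' hq' h
      simp only [Finset.mem_filter, Finset.mem_univ, true_and] at hq hq'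
      exact hq' (h.symm.trans hq)⟩

/-- The partially filled square given by a colouring of the vital subgraph with `n` colours: the
cells of a constraint with at least two cells carry the colour of that constraint (colours are
labelled `1, …, n`), all other cells are empty. -/
noncomputable def partialSquare {ι : Type*} [Fintype ι] {x : ι → ℂ} {s : ℂ} {n : ℕ}
    (κ : (vitalGraph x s).Coloring (Fin n)) (a b : ι) : Option ℕ :=
  if h : 2 ≤ (constraintOf x s (a, b)).1.card then
    some ((κ ⟨constraintOf x s (a, b), h⟩ : ℕ) + 1)
  else none

/-- A Latin square with symbols `1, …, t`. -/
def IsLatinSquare {ι : Type*} (t : ℕ) (f : ι → ι → ℕ) : Prop :=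
  (∀ a b, f a b ∈ Set.Icc 1 t) ∧
  (∀ a, Function.Injective fun b => f a b) ∧
  (∀ b, Function.Injective fun a => f a b)

/-- A partially filled square can be completed to a Latin square with symbols `1, …, t`. -/
def Completable {ι : Type*} (t : ℕ) (L : ι → ι → Option ℕ) : Prop :=
  ∃ f : ι → ι → ℕ, IsLatinSquare t f ∧ ∀ a b q, L a b = some q → f a b = q

/-- `c 1, …, c n` lists, without repetition, the constraints with at least two cells. -/
def IsVitalLabelling {ι : Type*} (x : ι → ℂ) (s : ℂ) (n : ℕ) (c : ℕ → Finset (ι × ι)) : Prop :=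
  Set.BijOn c (Set.Icc 1 n) {d | IsConstraint x s d ∧ 2 ≤ d.card}

/-- With respect to the labelling `c 1, …, c n` of the vertices of the vital subgraph, the vertices
of colour `q` under `κ` are those whose label lies in `S q`. -/
def HasColorClasses {ι : Type*} {x : ι → ℂ} {s : ℂ} {t : ℕ}
    (κ : (vitalGraph x s).Coloring (Fin t)) (n : ℕ) (c : ℕ → Finset (ι × ι))
    (S : Fin t → Set ℕ) : Prop :=
  ∀ w, ∀ v ∈ Set.Icc 1 n, w.1.1 = c v → ∀ q, κ w = q ↔ v ∈ S q

/-- The `M`-PSK signal set; the label `m ∈ {1, …, M}` of a point is represented by the residue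
`m - 1`. -/
noncomputable def psk (M : ℕ) (r : ZMod M) : ℂ :=
  Complex.exp (Complex.I * ((2 * (r.val : ℝ) + 1) * Real.pi / M : ℝ))

/-- The fade state `sin (π k / M) / sin (π l / M)`. -/
noncomputable def fadeEven (M k l : ℕ) : ℂ :=
  (Real.sin (Real.pi * k / M) / Real.sin (Real.pi * l / M) : ℝ)

/-- The fade state `sin (π k / M) / sin (π l / M) * exp (j π / M)`. -/
noncomputable def fadeMixed (M k l : ℕ) : ℂ :=
  fadeEven M k l * Complex.exp (Complex.I * (Real.pi / M : ℝ))

/-- The labelled constraints `c 1, …, c (2 * M)`, where `e = 0` if `k`, `l` have the same parity and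
`e = 1` otherwise (so that the divisions by two are exact). Label `i + 1` is the first kind of
constraint and label `M + i + 1` the second, `0 ≤ i < M`; rows and columns are residues mod `M`. -/
def pskConstraint (M : ℕ) (e k l : ℤ) (v : ℕ) : Finset (ZMod M × ZMod M) :=
  if v ≤ M then
    let i : ℤ := v - 1
    {(((i : ℤ) : ZMod M), ((i - M / 2 - (k + e - l) / 2 : ℤ) : ZMod M)),
      (((i - k : ℤ) : ZMod M), ((i + M / 2 - (k + e + l) / 2 : ℤ) : ZMod M))}
  else
    let i : ℤ := v - M - 1
    {(((i : ℤ) : ZMod M), ((i - (k + e + l) / 2 : ℤ) : ZMod M)),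
      (((i - k : ℤ) : ZMod M), ((i - (k + e - l) / 2 : ℤ) : ZMod M))}

/-- The set `U_{i,j}` (for `off = 0`) and `V_{i,j}` (for `off = M`), `i, j ≥ 1`. -/
def block2 (off m₁ m₂ i j : ℕ) : Set ℕ :=
  Set.Icc (off + (j - 1) * 2 ^ (m₂ + 1) + (i - 1) * 2 ^ m₁ + 1)
    (off + (j - 1) * 2 ^ (m₂ + 1) + i * 2 ^ m₁)

/-- The union of the blocks `(i, j)` with `lo ≤ i ≤ hi`, `i` of the given parity, and
`1 ≤ j ≤ 2 ^ (lam - m₂ - 1)`. -/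
def blockUnion2 (lam m₁ m₂ off lo hi : ℕ) (parity : ℕ → Prop) : Set ℕ :=
  {v | ∃ i j, lo ≤ i ∧ i ≤ hi ∧ parity i ∧ 1 ≤ j ∧ j ≤ 2 ^ (lam - m₂ - 1) ∧
    v ∈ block2 off m₁ m₂ i j}

/-- The eight colour classes for `k`, `l` both even, with 2-adic valuations `m₁ < m₂`. -/
def evenClasses (lam m₁ m₂ : ℕ) : Fin 8 → Set ℕ :=
  ![blockUnion2 lam m₁ m₂ 0 1 (2 ^ (m₂ - m₁)) Odd,
    blockUnion2 lam m₁ m₂ 0 1 (2 ^ (m₂ - m₁)) Even,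
    blockUnion2 lam m₁ m₂ 0 (2 ^ (m₂ - m₁) + 1) (2 ^ (m₂ - m₁ + 1)) Odd,
    blockUnion2 lam m₁ m₂ 0 (2 ^ (m₂ - m₁) + 1) (2 ^ (m₂ - m₁ + 1)) Even,
    blockUnion2 lam m₁ m₂ (2 ^ lam) 1 (2 ^ (m₂ - m₁)) Odd,
    blockUnion2 lam m₁ m₂ (2 ^ lam) 1 (2 ^ (m₂ - m₁)) Even,
    blockUnion2 lam m₁ m₂ (2 ^ lam) (2 ^ (m₂ - m₁) + 1) (2 ^ (m₂ - m₁ + 1)) Odd,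
    blockUnion2 lam m₁ m₂ (2 ^ lam) (2 ^ (m₂ - m₁) + 1) (2 ^ (m₂ - m₁ + 1)) Even]

/-- The union, over `1 ≤ i ≤ 2 ^ (lam - m)` with `i` of the given parity, of the sets
`{off + (i - 1) 2 ^ m + u, off + (i - 1) 2 ^ m + u + 2, …}` of numbers up to `off + i 2 ^ m`; here
`u = 1` gives the odd and `u = 2` the even half of a block. -/
def blockUnion1 (lam m off u : ℕ) (parity : ℕ → Prop) : Set ℕ :=
  {v | ∃ i, 1 ≤ i ∧ i ≤ 2 ^ (lam - m) ∧ parity i ∧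
    ∃ t, v = off + (i - 1) * 2 ^ m + u + 2 * t ∧ v ≤ off + i * 2 ^ m}

/-- The eight colour classes for `k`, `l` of different parity, the even one having 2-adic
valuation `m`. -/
def mixedClasses (lam m : ℕ) : Fin 8 → Set ℕ :=
  ![blockUnion1 lam m 0 1 Odd, blockUnion1 lam m 0 1 Even,
    blockUnion1 lam m 0 2 Odd, blockUnion1 lam m 0 2 Even,
    blockUnion1 lam m (2 ^ lam) 1 Odd, blockUnion1 lam m (2 ^ lam) 1 Even,
    blockUnion1 lam m (2 ^ lam) 2 Odd, blockUnion1 lam m (2 ^ lam) 2 Even]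

/-! A collision of two cells says x_a - x_a' = s (x_b' - x_b). A difference of two PSK points is a
root of unity times 2i sin(dπ/M), where d is the difference of the labels. Taking moduli gives
sin(dπ/M) sin(lπ/M) = sin(kπ/M) sin(cπ/M) with acute angles, d and c being the absolute label
differences. Since M is a power of two, the cosines of acute multiples of π/M are linearly
independent over the integers. Product-to-sum therefore makes the factors unique
(`sin_mul_sin_unique`), and k ≠ l forces d = k and c = l. Comparing phases then fixes the column in
terms of the row (`collision_iff`). The result is two families of M disjoint two-cell classes, which
together fill exactly four cyclic diagonals, on which column minus row is constant.

In binary, a colour class consists of one family and prescribed digits of the index at positions u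
and w, the 2-adic valuations of k and l in some order. A shift of exact valuation u or w flips that
digit and so changes the colour. Each family uses four symbols on its two diagonals. Two more
diagonals per family, carrying shifted copies of the same digit pattern, make every row and column
contain all four symbols. The shifts are combinations of k, l and M/2 whose valuations can be read
off their coefficients, so the verification is a finite table. The other M - 8 diagonals are each
constant, with a symbol of their own (`exists_latinSquare_of_diagonals`). Properness of the
colouring follows from the Latin square (`vital_conclusion`). -/

/-! ### Linear independence of cosines and unique sine products -/

/-- The cosines `cos (j π / 2 ^ (n + 1))`, `0 ≤ j < 2 ^ n`, are linearly independent over `ℤ`. -/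
theorem cos_linear_independent (n : ℕ) (c : ℕ → ℤ)
    (h : ∑ j ∈ Finset.range (2 ^ n), (c j : ℝ) * Real.cos (j * Real.pi / 2 ^ (n + 1)) = 0) :
    ∀ j < 2 ^ n, c j = 0 := by
  open Polynomial in
  obtain ⟨N, hN⟩ : ∃ N, N = 2 ^ n := ⟨_, rfl⟩
  have hN1 : 1 ≤ N := hN ▸ Nat.one_le_two_pow
  set ζ : ℂ := Complex.exp (2 * Real.pi * Complex.I / ((2 ^ (n + 2) : ℕ) : ℂ)) with hζ
  have hprim : IsPrimitiveRoot ζ (2 ^ (n + 2)) :=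
    Complex.isPrimitiveRoot_exp _ (by positivity)
  have hζ0 : ζ ≠ 0 := Complex.exp_ne_zero _
  have hcos (j : ℕ) : ζ ^ j + (ζ⁻¹) ^ j
      = 2 * ((Real.cos (j * Real.pi / 2 ^ (n + 1)) : ℝ) : ℂ) := by
    rw [Complex.ofReal_cos, Complex.two_cos, hζ, ← Complex.exp_neg, ← Complex.exp_nat_mul,
      ← Complex.exp_nat_mul]
    congr 2
    · push_cast; ring
    · push_cast; ring
  -- The relation in ζ + ζ⁻¹ form, multiplied by ζ ^ (N - 1) to clear negative exponents.
  let P : ℤ[X] := ∑ j ∈ Finset.range N, C (c j) * (X ^ (N - 1 + j) + X ^ (N - 1 - j))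
  have hP : aeval ζ P = 0 := by
    have h1 : ∀ j ∈ Finset.range N, aeval ζ (C (c j) * (X ^ (N - 1 + j) + X ^ (N - 1 - j)))
        = ζ ^ (N - 1) * 2 * (((c j : ℝ) * Real.cos (j * Real.pi / 2 ^ (n + 1)) : ℝ) : ℂ) := by
      intro j hj
      have hj' : j ≤ N - 1 := by have := Finset.mem_range.1 hj; omega
      have h2 : ζ ^ (N - 1 - j) = ζ ^ (N - 1) * (ζ⁻¹) ^ j := by
        rw [pow_sub₀ _ hζ0 hj', inv_pow]
      have := hcos j
      simp only [map_mul, map_add, map_pow, aeval_X, h2, pow_add ζ]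
      simp only [eq_intCast, map_intCast]
      rw [Complex.ofReal_mul, Complex.ofReal_intCast]
      linear_combination (c j : ℂ) * ζ ^ (N - 1) * this
    simp only [P, map_sum]
    rw [Finset.sum_congr rfl h1, ← Finset.mul_sum, ← Complex.ofReal_sum, hN, h]
    simp
  have hdeg : P.natDegree < 2 * N := by
    refine lt_of_le_of_lt (natDegree_sum_le_of_forall_le (n := 2 * N - 2) _ _ ?_) (by omega)
    intro j hj
    have := Finset.mem_range.1 hj
    refine (natDegree_C_mul_le _ _).trans ((natDegree_add_le _ _).trans ?_)
    simp only [natDegree_X_pow]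
    omega
  -- The minimal polynomial of ζ is cyclotomic of degree φ(4N) = 2N, which exceeds the degree of P.
  have hP0 : P = 0 := by
    by_contra hne
    have hint : IsIntegral ℤ ζ := hprim.isIntegral (by positivity)
    have hd := minpoly.isIntegrallyClosed_dvd hint hP
    have hle := natDegree_le_of_dvd hd hne
    rw [← cyclotomic_eq_minpoly hprim (by positivity), natDegree_cyclotomic,
      Nat.totient_prime_pow Nat.prime_two (by omega)] at hle
    rw [show n + 2 - 1 = n + 1 by omega, pow_succ, ← hN] at hle
    omega
  intro j hj
  rw [← hN] at hj
  -- This coefficient is c j, except that for j = 0 both monomials coincide and it is 2 * c 0.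
  have hc : P.coeff (N - 1 + j) = 0 := by rw [hP0]; simp
  simp only [P, finsetSum_coeff, coeff_C_mul, coeff_add, coeff_X_pow] at hc
  rw [Finset.sum_eq_single j] at hc
  · simp only [if_true] at hc
    split_ifs at hc <;> omega
  · intro i hi hij
    have := Finset.mem_range.1 hi
    rw [if_neg (by omega), if_neg (by omega)]; simp
  · intro h; exact absurd (Finset.mem_range.2 hj) h

/-- Expansion of `cos (B π / 2 ^ (n + 1))` in the cosines of acute multiples. -/
theorem cos_eq_sum_acute (n B : ℕ) (hB : B ≤ 2 ^ (n + 1)) :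
    Real.cos (B * Real.pi / 2 ^ (n + 1)) = ∑ j ∈ Finset.range (2 ^ n),
      ((((if j = B then 1 else 0) - (if j + B = 2 ^ (n + 1) then 1 else 0) : ℤ)) : ℝ)
        * Real.cos (j * Real.pi / 2 ^ (n + 1)) := by
  have hpow : (2 : ℕ) ^ (n + 1) = 2 * 2 ^ n := by rw [pow_succ]; ring
  have hpowR : (2 : ℝ) ^ (n + 1) = 2 * 2 ^ n := by rw [pow_succ]; ring
  rcases lt_trichotomy B (2 ^ n) with h | h | h
  · rw [Finset.sum_eq_single B]
    · rw [if_pos rfl, if_neg (by omega)]; simp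
    · intro i hi hij
      have := Finset.mem_range.1 hi
      rw [if_neg hij, if_neg (by omega)]; simp
    · intro h'; exact absurd (Finset.mem_range.2 h) h'
  · rw [Finset.sum_eq_zero]
    · have : (B : ℝ) * Real.pi / 2 ^ (n + 1) = Real.pi / 2 := by
        rw [h, hpowR]; push_cast; field_simp
      rw [this, Real.cos_pi_div_two]
    · intro i hi
      have := Finset.mem_range.1 hi
      rw [if_neg (by omega), if_neg (by omega)]; simp
  · rw [Finset.sum_eq_single (2 ^ (n + 1) - B)]
    · rw [if_neg (by omega), if_pos (by omega)]
      have : (((2 ^ (n + 1) - B : ℕ) : ℝ)) * Real.pi / 2 ^ (n + 1)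
          = Real.pi - B * Real.pi / 2 ^ (n + 1) := by
        rw [Nat.cast_sub hB]; push_cast; field_simp
      rw [this, Real.cos_pi_sub]; simp
    · intro i hi hij
      have := Finset.mem_range.1 hi
      rw [if_neg (by omega), if_neg (by omega)]; simp
    · intro h'; exact absurd (Finset.mem_range.2 (by omega)) h'

/-- Linear independence applied after folding all angles into the acute range. Indicators keep the
folding explicit, so the later case analysis is linear arithmetic. -/
theorem coeff_eq_of_cos_sub_cos_eq (n A B C D : ℕ) (hA : A ≤ 2 ^ (n + 1)) (hB : B ≤ 2 ^ (n + 1))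
    (hC : C ≤ 2 ^ (n + 1)) (hD : D ≤ 2 ^ (n + 1))
    (h : Real.cos (A * Real.pi / 2 ^ (n + 1)) - Real.cos (B * Real.pi / 2 ^ (n + 1))
      = Real.cos (C * Real.pi / 2 ^ (n + 1)) - Real.cos (D * Real.pi / 2 ^ (n + 1)))
    (j : ℕ) (hj : j < 2 ^ n) :
    (((if j = A then 1 else 0) - (if j + A = 2 ^ (n + 1) then 1 else 0) : ℤ)
      - ((if j = B then 1 else 0) - (if j + B = 2 ^ (n + 1) then 1 else 0)))
      - (((if j = C then 1 else 0) - (if j + C = 2 ^ (n + 1) then 1 else 0))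
      - ((if j = D then 1 else 0) - (if j + D = 2 ^ (n + 1) then 1 else 0))) = 0 := by
  refine cos_linear_independent n (fun j =>
    (((if j = A then 1 else 0) - (if j + A = 2 ^ (n + 1) then 1 else 0) : ℤ)
      - ((if j = B then 1 else 0) - (if j + B = 2 ^ (n + 1) then 1 else 0)))
      - (((if j = C then 1 else 0) - (if j + C = 2 ^ (n + 1) then 1 else 0))
      - ((if j = D then 1 else 0) - (if j + D = 2 ^ (n + 1) then 1 else 0)))) ?_ j hj
  rw [cos_eq_sum_acute n A hA, cos_eq_sum_acute n B hB, cos_eq_sum_acute n C hC,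
    cos_eq_sum_acute n D hD, ← sub_eq_zero] at h
  simp only [← Finset.sum_sub_distrib] at h
  rw [← h]
  refine Finset.sum_congr rfl fun i _ => ?_
  push_cast
  ring

/-- Products of two sines of acute multiples of `π / 2 ^ (n + 1)` have unique factors. -/
theorem sin_mul_sin_unique (n a b c d : ℕ) (ha : 1 ≤ a) (ha' : a ≤ 2 ^ n) (hb : 1 ≤ b)
    (hb' : b ≤ 2 ^ n) (hc : 1 ≤ c) (hc' : c ≤ 2 ^ n) (hd : 1 ≤ d) (hd' : d ≤ 2 ^ n)
    (h : Real.sin (a * Real.pi / 2 ^ (n + 1)) * Real.sin (b * Real.pi / 2 ^ (n + 1))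
      = Real.sin (c * Real.pi / 2 ^ (n + 1)) * Real.sin (d * Real.pi / 2 ^ (n + 1))) :
    a = c ∧ b = d ∨ a = d ∧ b = c := by
  wlog hab : b ≤ a generalizing a b
  · have := this b a hb hb' ha ha' (by rw [mul_comm, h]) (by omega)
    tauto
  wlog hcd : d ≤ c generalizing c d
  · have := this d c hd hd' hc hc' (by rw [h, mul_comm]) (by omega)
    tauto
  have key (x y : ℕ) (hxy : y ≤ x) :
      2 * (Real.sin (x * Real.pi / 2 ^ (n + 1)) * Real.sin (y * Real.pi / 2 ^ (n + 1)))
      = Real.cos ((x - y : ℕ) * Real.pi / 2 ^ (n + 1))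
        - Real.cos ((x + y : ℕ) * Real.pi / 2 ^ (n + 1)) := by
    rw [Nat.cast_sub hxy, Nat.cast_add, sub_mul, add_mul, sub_div, add_div, Real.cos_sub,
      Real.cos_add]
    ring
  have hpow : (2 : ℕ) ^ (n + 1) = 2 * 2 ^ n := by rw [pow_succ]; ring
  have hE := coeff_eq_of_cos_sub_cos_eq n (a - b) (a + b) (c - d) (c + d) (by omega) (by omega)
    (by omega) (by omega) (by rw [← key a b hab, ← key c d hcd, h])
  rw [hpow] at hE
  clear hpow key h
  generalize 2 ^ n = N at *
  have hsub : a - b = c - d := by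
    -- If the differences disagree, the coefficients at a - b and c - d can only cancel when a - b +
    -- c + d = 2N and c - d + a + b = 2N. Adding gives a = c = N, and then the coefficient picks up
    -- a second unit that nothing cancels.
    by_contra hne
    have e := hE (a - b) (by omega)
    rw [if_pos rfl, if_neg (by omega), if_neg (by omega), if_neg hne, if_neg (by omega)] at e
    have e' := hE (c - d) (by omega)
    rw [if_neg (Ne.symm hne), if_neg (by omega), if_pos rfl, if_neg (by omega),
      if_neg (by omega : ¬ c - d = c + d)] at e'
    omega
  rw [hsub] at hE
  have hadd : a + b = c + d := by
    by_contra hne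
    rcases lt_trichotomy (a + b) N with h1 | h1 | h1
    · have e := hE (a + b) h1
      rw [if_pos rfl, if_neg (by omega : ¬ a + b + (a + b) = 2 * N), if_neg hne] at e
      omega
    · rcases lt_trichotomy (c + d) N with h2 | h2 | h2
      · have e := hE (c + d) h2
        rw [if_pos rfl, if_neg (by omega : ¬ c + d + (c + d) = 2 * N), if_neg (Ne.symm hne)] at e
        omega
      · omega
      · have e := hE (2 * N - (c + d)) (by omega)
        omega
    · have e := hE (2 * N - (a + b)) (by omega)
      omega
  omega

/-! ### Collisions of cells: moduli and phases -/

/-- The root of unity `exp (j n π / M)`. -/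
noncomputable def unitRoot (M : ℕ) (n : ℤ) : ℂ :=
  Complex.exp (Complex.I * ((n * Real.pi / M : ℝ) : ℂ))

theorem unitRoot_add (M : ℕ) (n m : ℤ) : unitRoot M (n + m) = unitRoot M n * unitRoot M m := by
  rw [unitRoot, unitRoot, unitRoot, ← Complex.exp_add]
  congr 1
  push_cast
  ring

theorem norm_unitRoot (M : ℕ) (n : ℤ) : ‖unitRoot M n‖ = 1 := by
  rw [unitRoot, mul_comm, Complex.norm_exp_ofReal_mul_I]

theorem unitRoot_eq_iff {M : ℕ} (hM : M ≠ 0) (n m : ℤ) :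
    unitRoot M n = unitRoot M m ↔ (2 * M : ℤ) ∣ n - m := by
  have hM' : (M : ℂ) ≠ 0 := Nat.cast_ne_zero.2 hM
  have hpi : (Real.pi : ℂ) ≠ 0 := Complex.ofReal_ne_zero.2 Real.pi_ne_zero
  rw [unitRoot, unitRoot, Complex.exp_eq_exp_iff_exists_int]
  constructor
  · rintro ⟨z, hz⟩
    refine ⟨z, ?_⟩
    have h1 : ((n : ℂ) - m - 2 * M * z) * (Complex.I * Real.pi / M) = 0 := by
      push_cast at hz
      have : (2 * M * z : ℂ) * (Complex.I * Real.pi / M) = z * (2 * Real.pi * Complex.I) := by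
        field_simp
      rw [sub_mul, this]
      linear_combination hz
    rcases mul_eq_zero.1 h1 with h2 | h2
    · have : ((n - m - 2 * M * z : ℤ) : ℂ) = 0 := by push_cast; exact h2
      have := Int.cast_eq_zero.1 this
      linarith
    · exact absurd h2 (by simp [hM', hpi])
  · rintro ⟨z, hz⟩
    refine ⟨z, ?_⟩
    have : n = m + 2 * M * z := by linarith
    rw [this]
    push_cast
    field_simp

theorem unitRoot_add_self {M : ℕ} (hM : M ≠ 0) (n : ℤ) : unitRoot M (n + M) = -unitRoot M n := by
  have : unitRoot M M = -1 := by
    have hM' : (M : ℝ) ≠ 0 := Nat.cast_ne_zero.2 hM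
    rw [unitRoot, show ((M : ℤ) * Real.pi / M : ℝ) = Real.pi by push_cast; field_simp, mul_comm,
      Complex.exp_pi_mul_I]
  rw [unitRoot_add, this, mul_neg_one]

theorem psk_intCast (M : ℕ) [NeZero M] (n : ℤ) : psk M (n : ZMod M) = unitRoot M (2 * n + 1) := by
  have h1 : psk M (n : ZMod M) = unitRoot M (2 * ((n : ZMod M).val : ℤ) + 1) := by
    rw [psk, unitRoot]
    push_cast
    rfl
  rw [h1, unitRoot_eq_iff (NeZero.ne M), ZMod.val_intCast]
  refine ⟨-(n / M), ?_⟩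
  have := Int.emod_add_mul_ediv n M
  linear_combination 2 * this

theorem unitRoot_sub_unitRoot (M : ℕ) (n m : ℤ) :
    unitRoot M (2 * n + 1) - unitRoot M (2 * m + 1)
      = unitRoot M (n + m + 1) * (2 * Complex.I * (Real.sin ((n - m : ℤ) * Real.pi / M) : ℂ)) := by
  rw [show 2 * n + 1 = (n + m + 1) + (n - m) by ring,
    show 2 * m + 1 = (n + m + 1) + -(n - m) by ring,
    unitRoot_add M (n + m + 1) (n - m), unitRoot_add M (n + m + 1) (-(n - m)), ← mul_sub]
  congr 1
  rw [unitRoot, unitRoot, Complex.ofReal_sin, mul_comm 2 Complex.I, mul_assoc, Complex.two_sin]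
  have h : Complex.I * (((-(n - m) : ℤ) * Real.pi / M : ℝ) : ℂ)
      = -((((n - m : ℤ) * Real.pi / M : ℝ) : ℂ)) * Complex.I := by push_cast; ring
  rw [h, mul_comm Complex.I (((n - m : ℤ) * Real.pi / M : ℝ) : ℂ)]
  linear_combination -(Complex.exp (-((((n - m : ℤ) * Real.pi / M : ℝ) : ℂ)) * Complex.I)
    - Complex.exp (((((n - m : ℤ) * Real.pi / M : ℝ) : ℂ)) * Complex.I)) * Complex.I_mul_I

/-- The fade state with parameters `k`, `l` and phase `e π / M`. -/
noncomputable def fadeState (M k l : ℕ) (e : ℤ) : ℂ := fadeEven M k l * unitRoot M e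

theorem sin_pos_of_lt {M k : ℕ} (hk : 1 ≤ k) (hkM : k < M) :
    0 < Real.sin (k * Real.pi / M) := by
  have hM : (0 : ℝ) < M := by exact_mod_cast (by omega : 0 < M)
  have hk0 : (0 : ℝ) < k := by exact_mod_cast hk
  refine Real.sin_pos_of_pos_of_lt_pi (by positivity) ?_
  rw [div_lt_iff₀ hM, mul_comm]
  exact mul_lt_mul_of_pos_left (by exact_mod_cast hkM) Real.pi_pos

/-- Both differences of signal points are factored into phase times sine, and the denominator
sin(lπ/M) of the fade state is cleared. Real factors and phases can then be compared separately. -/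
theorem collision_iff_int {M k l : ℕ} [NeZero M] (hl : 1 ≤ l) (hlM : l < M) (e a a' b b' : ℤ) :
    psk M (a : ZMod M) + fadeState M k l e * psk M (b : ZMod M)
      = psk M (a' : ZMod M) + fadeState M k l e * psk M (b' : ZMod M) ↔
    unitRoot M (a + a' + 1) * ((Real.sin ((a - a' : ℤ) * Real.pi / M)
        * Real.sin (l * Real.pi / M) : ℝ) : ℂ)
      = unitRoot M (e + b + b' + 1) * ((Real.sin (k * Real.pi / M)
        * Real.sin ((b' - b : ℤ) * Real.pi / M) : ℝ) : ℂ) := by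
  have hs : (Real.sin (l * Real.pi / M) : ℂ) ≠ 0 :=
    Complex.ofReal_ne_zero.2 (sin_pos_of_lt hl hlM).ne'
  have hA := unitRoot_sub_unitRoot M a a'
  have hB := unitRoot_sub_unitRoot M b' b
  have hfade : fadeState M k l e * (Real.sin (l * Real.pi / M) : ℂ)
      = (Real.sin (k * Real.pi / M) : ℂ) * unitRoot M e := by
    rw [fadeState, fadeEven, mul_comm Real.pi (l : ℝ), mul_comm Real.pi (k : ℝ),
      Complex.ofReal_div, mul_right_comm, div_mul_cancel₀ _ hs]
  have hE : unitRoot M (e + b + b' + 1) = unitRoot M e * unitRoot M (b' + b + 1) := by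
    rw [← unitRoot_add]; congr 1; ring
  rw [hE, psk_intCast, psk_intCast, psk_intCast, psk_intCast]
  generalize fadeState M k l e = s at *
  generalize Real.sin (l * Real.pi / M) = sl at *
  generalize Real.sin (k * Real.pi / M) = sk at *
  generalize Real.sin ((a - a' : ℤ) * Real.pi / M) = sa at *
  generalize Real.sin ((b' - b : ℤ) * Real.pi / M) = sb at *
  push_cast
  have h2I : (2 * Complex.I : ℂ) ≠ 0 := by simp
  constructor
  · intro h
    apply mul_left_cancel₀ h2I
    linear_combination (-(sl : ℂ)) * hA + s * sl * hB + (sl : ℂ) * h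
      + unitRoot M (b' + b + 1) * 2 * Complex.I * sb * hfade
  · intro h
    apply mul_right_cancel₀ hs
    linear_combination ((sl : ℂ)) * hA - s * sl * hB + 2 * Complex.I * h
      - unitRoot M (b' + b + 1) * 2 * Complex.I * sb * hfade

/-- The two sine products coincide, so only the phases matter: their exponents differ by 2(a - h -
b), which has to vanish modulo 2M. -/
theorem collision_add_iff {M k l : ℕ} [NeZero M] (hk : 1 ≤ k) (hkM : k < M) (hl : 1 ≤ l)
    (hlM : l < M) (e h : ℤ) (hh : 2 * h = k + e + l) (a b : ZMod M) :
    psk M a + fadeState M k l e * psk M b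
      = psk M (a - k) + fadeState M k l e * psk M (b + l) ↔ b = a - h := by
  obtain ⟨a, rfl⟩ := ZMod.intCast_surjective a
  obtain ⟨b, rfl⟩ := ZMod.intCast_surjective b
  have h1 := collision_iff_int (k := k) hl hlM e a (a - k) b (b + l)
  have h2 : (((a - k : ℤ) : ZMod M)) = a - k := by push_cast; rfl
  have h3 : (((b + l : ℤ) : ZMod M)) = b + l := by push_cast; rfl
  rw [h2, h3] at h1
  rw [h1, sub_sub_cancel, add_sub_cancel_left]
  have hne : ((Real.sin (k * Real.pi / M) * Real.sin (l * Real.pi / M) : ℝ) : ℂ) ≠ 0 :=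
    Complex.ofReal_ne_zero.2 (mul_pos (sin_pos_of_lt hk hkM) (sin_pos_of_lt hl hlM)).ne'
  rw [Int.cast_natCast, Int.cast_natCast, mul_left_inj' hne, unitRoot_eq_iff (NeZero.ne M),
    show a + (a - k) + 1 - (e + b + (b + l) + 1) = 2 * (a - h - b) by linear_combination hh,
    Int.mul_dvd_mul_iff_left two_ne_zero, ← Int.cast_sub, ZMod.intCast_eq_intCast_iff_dvd_sub]

/-- As in `collision_add_iff`, but the sine of the column difference is negative. The sign is
absorbed as M = 2H in the exponent, which moves the column by H. -/
theorem collision_sub_iff {M k l H : ℕ} [NeZero M] (hk : 1 ≤ k) (hkM : k < M) (hl : 1 ≤ l)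
    (hlM : l < M) (hH : M = 2 * H) (e h : ℤ) (hh : 2 * h = k + e + l) (a b : ZMod M) :
    psk M a + fadeState M k l e * psk M b
      = psk M (a - k) + fadeState M k l e * psk M (b - l) ↔ b = a - H + l - h := by
  obtain ⟨a, rfl⟩ := ZMod.intCast_surjective a
  obtain ⟨b, rfl⟩ := ZMod.intCast_surjective b
  have h1 := collision_iff_int (k := k) hl hlM e a (a - k) b (b - l)
  have h2 : (((a - k : ℤ) : ZMod M)) = a - k := by push_cast; rfl
  have h3 : (((b - l : ℤ) : ZMod M)) = b - l := by push_cast; rfl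
  rw [h2, h3] at h1
  rw [h1, sub_sub_cancel, sub_sub_cancel_left]
  have hne : ((Real.sin (k * Real.pi / M) * Real.sin (l * Real.pi / M) : ℝ) : ℂ) ≠ 0 :=
    Complex.ofReal_ne_zero.2 (mul_pos (sin_pos_of_lt hk hkM) (sin_pos_of_lt hl hlM)).ne'
  have hsin : Real.sin ((-(l : ℤ) : ℤ) * Real.pi / M) = -Real.sin (l * Real.pi / M) := by
    rw [← Real.sin_neg]; congr 1; push_cast; ring
  have hHZ : (M : ℤ) = 2 * H := by exact_mod_cast hH
  rw [Int.cast_natCast, hsin, mul_neg, Complex.ofReal_neg, mul_neg, ← neg_mul,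
    ← unitRoot_add_self (NeZero.ne M), mul_left_inj' hne, unitRoot_eq_iff (NeZero.ne M),
    show a + (a - k) + 1 - (e + b + (b - l) + 1 + M) = 2 * (a - H + l - h - b) by
      linear_combination hh - hHZ,
    Int.mul_dvd_mul_iff_left two_ne_zero,
    show ((a : ZMod M) - H + l - h) = ((a - H + l - h : ℤ) : ZMod M) by push_cast; rfl,
    ZMod.intCast_eq_intCast_iff_dvd_sub]

theorem abs_sin_eq {M : ℕ} [NeZero M] (d : ℤ) (hd : d.natAbs ≤ M) :
    |Real.sin (d * Real.pi / M)| = Real.sin (d.natAbs * Real.pi / M) := by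
  have hM : (0 : ℝ) < M := by exact_mod_cast Nat.pos_of_ne_zero (NeZero.ne M)
  have hpos : 0 ≤ Real.sin (d.natAbs * Real.pi / M) := by
    refine Real.sin_nonneg_of_nonneg_of_le_pi (by positivity) ?_
    rw [div_le_iff₀ hM, mul_comm]
    exact mul_le_mul_of_nonneg_left (by exact_mod_cast hd) Real.pi_pos.le
  rcases Int.natAbs_eq d with h | h
  · rw [show (d : ℝ) = d.natAbs by rw [← Int.cast_natCast, ← h]]
    exact abs_of_nonneg hpos
  · rw [show (d : ℝ) = -d.natAbs by rw [← Int.cast_natCast, ← Int.cast_neg, ← h], neg_mul, neg_div,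
      Real.sin_neg, abs_neg]
    exact abs_of_nonneg hpos

/-- Distinct colliding cells differ by `± k` in the row and by `± l` in the column. -/
theorem collision_differences {n M k l : ℕ} [NeZero M] (hM : M = 2 ^ (n + 1)) (hk : 1 ≤ k)
    (hkn : k ≤ 2 ^ n) (hl : 1 ≤ l) (hln : l ≤ 2 ^ n) (hkl : k ≠ l) (e : ℤ) (a a' b b' : ZMod M)
    (h : psk M a + fadeState M k l e * psk M b = psk M a' + fadeState M k l e * psk M b')
    (hne : ¬ (a = a' ∧ b = b')) :
    (a' = a - k ∨ a = a' - k) ∧ (b' = b + l ∨ b' = b - l) := by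
  have hM2 : M = 2 * 2 ^ n := by rw [hM, pow_succ]; ring
  have hn1 : 1 ≤ 2 ^ n := Nat.one_le_two_pow
  have hkM : k < M := by omega
  have hlM : l < M := by omega
  obtain ⟨a0, rfl⟩ := ZMod.intCast_surjective a'
  obtain ⟨b0, rfl⟩ := ZMod.intCast_surjective b
  -- Representatives of least absolute value keep the angles at most π/2, where sine products
  -- determine their factors.
  obtain ⟨d, hd, rfl⟩ : ∃ d : ℤ, d.natAbs ≤ 2 ^ n ∧ a = ((a0 + d : ℤ) : ZMod M) :=
    ⟨(a - a0).valMinAbs, by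
      have := ZMod.natAbs_valMinAbs_le (a - (a0 : ZMod M))
      omega, by push_cast; ring⟩
  obtain ⟨c, hc, rfl⟩ : ∃ d : ℤ, d.natAbs ≤ 2 ^ n ∧ b' = ((b0 + d : ℤ) : ZMod M) :=
    ⟨(b' - b0).valMinAbs, by
      have := ZMod.natAbs_valMinAbs_le (b' - (b0 : ZMod M))
      omega, by push_cast; ring⟩
  rw [collision_iff_int hl hlM] at h
  have hnorm := congrArg norm h
  rw [norm_mul, norm_mul, norm_unitRoot, norm_unitRoot, one_mul, one_mul, Complex.norm_real,
    Complex.norm_real, Real.norm_eq_abs, Real.norm_eq_abs, abs_mul, abs_mul,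
    abs_of_pos (sin_pos_of_lt hk hkM), abs_of_pos (sin_pos_of_lt hl hlM), add_sub_cancel_left,
    add_sub_cancel_left, abs_sin_eq d (by omega), abs_sin_eq c (by omega)] at hnorm
  have hd0 : d.natAbs = 0 ↔ c.natAbs = 0 := by
    constructor
    · intro h0
      by_contra hc0
      have := mul_pos (sin_pos_of_lt hk hkM)
        (sin_pos_of_lt (M := M) (k := c.natAbs) (by omega) (by omega))
      rw [← hnorm, h0] at this
      simp at this
    · intro h0
      by_contra hc0
      have := mul_pos (sin_pos_of_lt (M := M) (k := d.natAbs) (by omega) (by omega))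
        (sin_pos_of_lt hl hlM)
      rw [hnorm, h0] at this
      simp at this
  have hd1 : d.natAbs ≠ 0 := by
    intro h0
    have h1 := hd0.1 h0
    rw [Int.natAbs_eq_zero] at h0 h1
    exact hne (by simp [h0, h1])
  have hc1 : c.natAbs ≠ 0 := fun h0 => hd1 (hd0.2 h0)
  rw [show (M : ℝ) = 2 ^ (n + 1) by rw [hM]; push_cast; rfl] at hnorm
  -- The other matching of factors would give k = l.
  have hu := sin_mul_sin_unique n d.natAbs l k c.natAbs (by omega) hd hl hln hk hkn (by omega) hc
    hnorm
  have hdk : d.natAbs = k := by omega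
  have hcl : c.natAbs = l := by omega
  constructor
  · rcases Int.natAbs_eq d with h | h
    · left; rw [h, hdk]; push_cast; ring
    · right; rw [h, hdk]; push_cast; ring
  · rcases Int.natAbs_eq c with h | h
    · left; rw [h, hcl]; push_cast; ring
    · right; rw [h, hcl]; push_cast; ring

/-- The pairs of colliding cells, as two families indexed by the row of the first cell. -/
def cellPair {M : ℕ} (k l H h : ZMod M) (j : Bool × ZMod M) : Finset (ZMod M × ZMod M) :=
  if j.1 then {(j.2, j.2 - h), (j.2 - k, j.2 + l - h)}
  else {(j.2, j.2 - H + l - h), (j.2 - k, j.2 + H - h)}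

/-- Interchanging the two cells, if necessary, makes the row drop by k. The sign of the column
change then selects the family, and the phase condition selects the column. -/
theorem collision_iff {n M k l : ℕ} [NeZero M] (hM : M = 2 ^ (n + 1)) (hk : 1 ≤ k)
    (hkn : k ≤ 2 ^ n) (hl : 1 ≤ l) (hln : l ≤ 2 ^ n) (hkl : k ≠ l) (e h : ℤ)
    (hh : 2 * h = k + e + l) (p p' : ZMod M × ZMod M) :
    psk M p.1 + fadeState M k l e * psk M p.2 = psk M p'.1 + fadeState M k l e * psk M p'.2 ↔
      p = p' ∨ ∃ j, p ∈ cellPair (k : ZMod M) l (2 ^ n : ℕ) h j ∧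
        p' ∈ cellPair (k : ZMod M) l (2 ^ n : ℕ) h j := by
  have hM2 : M = 2 * 2 ^ n := by rw [hM, pow_succ]; ring
  have hn1 : 1 ≤ 2 ^ n := Nat.one_le_two_pow
  have hkM : k < M := by omega
  have hlM : l < M := by omega
  have hHH : ((2 ^ n : ℕ) : ZMod M) + ((2 ^ n : ℕ) : ZMod M) = 0 := by
    rw [← Nat.cast_add, ← two_mul, ← hM2, ZMod.natCast_self]
  obtain ⟨a, b⟩ := p
  obtain ⟨a', b'⟩ := p'
  have hadd := collision_add_iff hk hkM hl hlM e h hh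
  have hsub := collision_sub_iff hk hkM hl hlM hM2 e h hh
  generalize ((2 ^ n : ℕ) : ZMod M) = H at *
  constructor
  · intro hcol
    by_cases hne : a = a' ∧ b = b'
    · left; rw [hne.1, hne.2]
    right
    obtain ⟨h1, h2⟩ := collision_differences hM hk hkn hl hln hkl e a a' b b' hcol hne
    rcases h1 with rfl | rfl
    · rcases h2 with rfl | rfl
      · have hb := (hadd a b).1 hcol
        refine ⟨(true, a), ?_⟩
        rw [hb]
        simp [cellPair]
        right; ring
      · have hb := (hsub a b).1 hcol
        refine ⟨(false, a), ?_⟩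
        rw [hb]
        simp [cellPair]
        right; linear_combination -hHH
    · rcases h2 with rfl | rfl
      · have hb := (hsub a' (b + l)).1 (by simpa using hcol.symm)
        refine ⟨(false, a'), ?_⟩
        rw [hb, eq_sub_of_add_eq hb]
        simp [cellPair]
        right; linear_combination -hHH
      · have hb := (hadd a' (b - l)).1 (by simpa using hcol.symm)
        refine ⟨(true, a'), ?_⟩
        rw [hb, sub_eq_iff_eq_add.1 hb]
        simp [cellPair]
        right; ring
  · rintro (h1 | ⟨⟨t, i⟩, h1, h2⟩)
    · rw [h1]
    have e1 := (hadd i (i - h)).2 rfl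
    have e2 := (hsub i (i - H + l - h)).2 rfl
    rw [show i - h + (l : ZMod M) = i + l - h by ring] at e1
    rw [show i - H + l - h - (l : ZMod M) = i + H - h by linear_combination -hHH] at e2
    cases t
    · simp only [cellPair, Bool.false_eq_true, if_false, Finset.mem_insert, Finset.mem_singleton,
        Prod.mk.injEq] at h1 h2
      rcases h1 with ⟨rfl, rfl⟩ | ⟨rfl, rfl⟩ <;> rcases h2 with ⟨rfl, rfl⟩ | ⟨rfl, rfl⟩
      · rfl
      · exact e2
      · exact e2.symm
      · rfl
    · simp only [cellPair, if_true, Finset.mem_insert, Finset.mem_singleton,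
        Prod.mk.injEq] at h1 h2
      rcases h1 with ⟨rfl, rfl⟩ | ⟨rfl, rfl⟩ <;> rcases h2 with ⟨rfl, rfl⟩ | ⟨rfl, rfl⟩
      · rfl
      · exact e1
      · exact e1.symm
      · rfl

/-! ### From a Latin square to the coloured vital graph -/

/-- If the value classes with more than one cell are the sets `C j`, and a Latin square extends the
filling of `C j` by the symbol `χ j + 1`, then the `C j` are the vertices of the vital graph, `χ` is
a proper colouring and the resulting partial square is completable. -/
theorem vital_conclusion {ι J : Type*} [Fintype ι] {x : ι → ℂ} {s : ℂ} {n t m : ℕ}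
    (C : J → Finset (ι × ι))
    (hK : ∀ p p' : ι × ι, x p.1 + s * x p.2 = x p'.1 + s * x p'.2 ↔
      p = p' ∨ ∃ j, p ∈ C j ∧ p' ∈ C j)
    (hdisj : ∀ j j' p, p ∈ C j → p ∈ C j' → j = j')
    (hcard : ∀ j, 2 ≤ (C j).card)
    (φ : ℕ → J) (hφ : Set.BijOn φ (Set.Icc 1 n) Set.univ)
    (c : ℕ → Finset (ι × ι)) (hc : ∀ v ∈ Set.Icc 1 n, c v = C (φ v))
    (χ : J → Fin m) (f : ι → ι → ℕ) (hf : IsLatinSquare t f)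
    (hfC : ∀ j, ∀ p ∈ C j, f p.1 p.2 = χ j + 1)
    (S : Fin m → Set ℕ) (hS : ∀ v ∈ Set.Icc 1 n, ∀ q, χ (φ v) = q ↔ v ∈ S q) :
    IsVitalLabelling x s n c ∧
    ∃ κ : (vitalGraph x s).Coloring (Fin m),
      HasColorClasses κ n c S ∧ Completable t (partialSquare κ) := by
  have hCne (j : J) : (C j).Nonempty := Finset.card_pos.1 (by have := hcard j; omega)
  have hCcon (j : J) : IsConstraint x s (C j) := by
    refine ⟨hCne j, fun p hp p' hp' => (hK p p').2 (Or.inr ⟨j, hp, hp'⟩), fun p hp p' hp' h => ?_⟩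
    rcases (hK p p').1 h with rfl | ⟨j', h1, h2⟩
    · exact hp' hp
    · exact hp' (hdisj j j' p hp h1 ▸ h2)
  have hex (d : Finset (ι × ι)) (hd : IsConstraint x s d) (hd2 : 2 ≤ d.card) :
      ∃ j, d = C j := by
    obtain ⟨p, hp, p', hp', hne⟩ := Finset.one_lt_card.1 hd2
    rcases (hK p p').1 (hd.2.1 p hp p' hp') with h | ⟨j, h1, h2⟩
    · exact absurd h hne
    refine ⟨j, Finset.ext fun q => ⟨fun hq => ?_, fun hq => ?_⟩⟩
    · rcases (hK p q).1 (hd.2.1 p hp q hq) with rfl | ⟨j', h3, h4⟩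
      · exact h1
      · exact hdisj j j' p h1 h3 ▸ h4
    · by_contra hq'
      exact hd.2.2 p hp q hq' ((hK p q).2 (Or.inr ⟨j, h1, hq⟩))
  have hCinj (j j' : J) (h : C j = C j') : j = j' := by
    obtain ⟨p, hp⟩ := hCne j
    exact hdisj j j' p hp (h ▸ hp)
  refine ⟨⟨?_, ?_, ?_⟩, ?_⟩
  · intro v hv
    rw [hc v hv]
    exact ⟨hCcon _, hcard _⟩
  · intro v hv v' hv' h
    rw [hc v hv, hc v' hv'] at h
    exact hφ.2.1 hv hv' (hCinj _ _ h)
  · rintro d ⟨hd, hd2⟩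
    obtain ⟨j, rfl⟩ := hex d hd hd2
    obtain ⟨v, hv, rfl⟩ := hφ.2.2 (Set.mem_univ j)
    exact ⟨v, hv, hc v hv⟩
  · choose lab hlab using fun w : {c : {c : Finset (ι × ι) // IsConstraint x s c} //
      c ∈ {c : {c : Finset (ι × ι) // IsConstraint x s c} | 2 ≤ c.1.card}} => hex w.1.1 w.1.2 w.2
    have hlab' (w) (j : J) (h : w.1.1 = C j) : lab w = j := hCinj _ _ ((hlab w).symm.trans h)
    -- Properness is inherited from f: cells with the same symbol in a common row or column
    -- coincide, and by disjointness so do their classes.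
    let κ : (vitalGraph x s).Coloring (Fin m) := SimpleGraph.Coloring.mk (fun w => χ (lab w)) (by
      rintro w w' ⟨hne, p, hp, p', hp', h⟩ he
      replace hp : p ∈ w.1.1 := hp
      replace hp' : p' ∈ w'.1.1 := hp'
      rw [hlab w] at hp
      rw [hlab w'] at hp'
      have h1 := hfC _ p hp
      have h2 := hfC _ p' hp'
      have he' : f p.1 p.2 = f p'.1 p'.2 := by rw [h1, h2, he]
      have hpp : p = p' := by
        rcases h with h | h
        · refine Prod.ext h (hf.2.1 p.1 ?_)
          simpa [h] using he'
        · refine Prod.ext (hf.2.2 p.2 ?_) h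
          simpa [h] using he'
      apply hne
      apply Subtype.ext
      change w.1.1 = w'.1.1
      rw [hlab w, hlab w', hdisj _ _ p hp (hpp ▸ hp')])
    refine ⟨κ, ?_, f, hf, ?_⟩
    · intro w v hv hw q
      rw [hc v hv] at hw
      rw [← hS v hv q, ← hlab' w _ hw]
      rfl
    · intro a b q hq
      unfold partialSquare at hq
      split_ifs at hq with h2
      obtain ⟨j, hj⟩ := hex _ (constraintOf x s (a, b)).2 h2
      have hmem : (a, b) ∈ C j := by
        rw [← hj]
        simp [constraintOf]
      have := hfC j _ hmem
      have hκ : κ ⟨constraintOf x s (a, b), h2⟩ = χ j := by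
        rw [← hlab' ⟨constraintOf x s (a, b), h2⟩ j hj]
        rfl
      rw [hκ] at hq
      simp only [Option.some.injEq] at hq
      rw [← hq]
      exact this

/-! ### Latin squares built from cyclic diagonals -/

/-- Two groups of four symbols each fill four cyclic diagonals; the remaining diagonals are
constant. -/
theorem exists_latinSquare_of_diagonals {M : ℕ} [NeZero M] (g : ZMod M → Fin 4)
    (D σ : Fin 2 × Fin 4 → ZMod M) (hD : Function.Injective D)
    (hrow : ∀ t i j, i ≠ j → ∀ r, g (r + σ (t, i)) ≠ g (r + σ (t, j)))
    (hcol : ∀ t i j, i ≠ j → ∀ c, g (c + (σ (t, i) - D (t, i))) ≠ g (c + (σ (t, j) - D (t, j)))) :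
    ∃ f : ZMod M → ZMod M → ℕ, IsLatinSquare M f ∧
      ∀ n a, f a (a + D n) = 4 * (n.1 : ℕ) + g (a + σ n) + 1 := by
  classical
  have hcard : Fintype.card {d // d ∈ Set.range D} = 8 := by
    have h1 := Set.card_range_of_injective hD
    have h2 : Fintype.card (Fin 2 × Fin 4) = 8 := by simp
    rw [← h2, ← h1]
  have hle : 8 ≤ M := by
    have := Fintype.card_le_of_injective D hD
    simpa [ZMod.card] using this
  -- The eight listed diagonals use the symbols 1 to 8; each remaining one is assigned its own
  -- symbol from 9 to M.
  let e : {d // d ∉ Set.range D} ≃ Fin (M - 8) := Fintype.equivFinOfCardEq (by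
    rw [Fintype.card_subtype_compl, ZMod.card, hcard])
  let f : ZMod M → ZMod M → ℕ := fun a b =>
    if h : ∃ n, D n = b - a then 4 * (h.choose.1 : ℕ) + g (a + σ h.choose) + 1
    else e ⟨b - a, h⟩ + 9
  have hf1 (n a b) (h : D n = b - a) : f a b = 4 * (n.1 : ℕ) + g (a + σ n) + 1 := by
    have hex : ∃ n, D n = b - a := ⟨n, h⟩
    have : hex.choose = n := hD (hex.choose_spec.trans h.symm)
    simp only [f, dif_pos hex, this]
  have hf2 (a b) (h : ¬ ∃ n, D n = b - a) : f a b = e ⟨b - a, h⟩ + 9 := by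
    simp only [f, dif_neg h]
  have hsmall (n : Fin 2 × Fin 4) (y : Fin 4) : 4 * (n.1 : ℕ) + y + 1 ≤ 8 := by
    have := n.1.2; have := y.2; omega
  have hinj (a b a' b') (h : f a b = f a' b') :
      b - a = b' - a' ∨ ∃ t i j, i ≠ j ∧ D (t, i) = b - a ∧ D (t, j) = b' - a' ∧
        g (a + σ (t, i)) = g (a' + σ (t, j)) := by
    by_cases h1 : ∃ n, D n = b - a
    · obtain ⟨n, hn⟩ := h1
      by_cases h2 : ∃ n, D n = b' - a'
      · obtain ⟨n', hn'⟩ := h2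
        rw [hf1 n a b hn, hf1 n' a' b' hn'] at h
        obtain ⟨t, i⟩ := n
        obtain ⟨t', i'⟩ := n'
        have y1 := (g (a + σ (t, i))).2
        have y2 := (g (a' + σ (t', i'))).2
        have htt : t = t' := Fin.ext (by simp only at h; omega)
        subst htt
        by_cases hii : i = i'
        · left; rw [← hn, ← hn', hii]
        · right
          exact ⟨t, i, i', hii, hn, hn', Fin.ext (by simp only at h; omega)⟩
      · rw [hf1 n a b hn, hf2 a' b' h2] at h
        have := hsmall n (g (a + σ n))
        omega
    · by_cases h2 : ∃ n, D n = b' - a'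
      · obtain ⟨n', hn'⟩ := h2
        rw [hf2 a b h1, hf1 n' a' b' hn'] at h
        have := hsmall n' (g (a' + σ n'))
        omega
      · left
        rw [hf2 a b h1, hf2 a' b' h2] at h
        have : e ⟨b - a, h1⟩ = e ⟨b' - a', h2⟩ := Fin.ext (by omega)
        exact congrArg Subtype.val (e.injective this)
  refine ⟨f, ⟨?_, ?_, ?_⟩, fun n a => hf1 n a _ (by ring)⟩
  · intro a b
    by_cases h : ∃ n, D n = b - a
    · obtain ⟨n, hn⟩ := h
      rw [hf1 n a b hn]
      have := hsmall n (g (a + σ n))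
      exact ⟨by omega, by omega⟩
    · rw [hf2 a b h]
      have := (e ⟨b - a, h⟩).2
      exact ⟨by omega, by omega⟩
  · intro a b b' h
    rcases hinj a b a b' h with h | ⟨t, i, j, hij, -, -, h⟩
    · exact sub_left_injective h
    · exact absurd h (hrow t i j hij a)
  · intro b a a' h
    rcases hinj a b a' b h with h | ⟨t, i, j, hij, h1, h2, h⟩
    · exact sub_right_injective h
    -- In column b, the diagonal D is met in row b - D, so the effective shift is σ - D.
    · refine absurd ?_ (hcol t i j hij b)
      rw [h1, h2, show b + (σ (t, i) - (b - a)) = a + σ (t, i) by ring,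
        show b + (σ (t, j) - (b - a')) = a' + σ (t, j) by ring]
      exact h

/-! ### Binary digits as colours -/

/-- The colour of a residue: the binary digits at the positions `u` and `w`. -/
def digitColor {M : ℕ} (u w : ℕ) (r : ZMod M) : Fin 4 :=
  ⟨r.val / 2 ^ u % 2 + 2 * (r.val / 2 ^ w % 2), by omega⟩

/-- An odd multiple of 2 ^ u changes the quotient by 2 ^ u by an odd number. Reduction modulo M
preserves the parity of that quotient, as 2 ^ (u + 1) divides M. -/
theorem digit_add_ne {M : ℕ} [NeZero M] {u : ℕ} (hu : 2 ^ (u + 1) ∣ M) (r : ZMod M) (x c : ℤ)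
    (hx : x = 2 ^ u * (2 * c + 1)) :
    (r + (x : ZMod M)).val / 2 ^ u % 2 ≠ r.val / 2 ^ u % 2 := by
  have hdvd : ((2 : ℤ) ^ (u + 1)) ∣ ((r + (x : ZMod M)).val : ℤ) - (r.val + x) := by
    have h1 : ((2 : ℤ) ^ (u + 1)) ∣ (M : ℤ) := by exact_mod_cast hu
    refine h1.trans ?_
    rw [← ZMod.intCast_eq_intCast_iff_dvd_sub]
    push_cast
    simp
  obtain ⟨z, hz⟩ := hdvd
  have hpos : (0 : ℤ) < 2 ^ u := by positivity
  have hval : ((r + (x : ZMod M)).val : ℤ) = r.val + 2 ^ u * (2 * (c + z) + 1) := by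
    rw [hx, pow_succ] at hz
    rw [hx]
    linear_combination hz
  intro h
  have h' : (((r + (x : ZMod M)).val : ℤ)) / 2 ^ u % 2 = (r.val : ℤ) / 2 ^ u % 2 := by
    exact_mod_cast h
  rw [hval, Int.add_mul_ediv_left _ _ hpos.ne'] at h'
  omega

theorem digitColor_add_ne {M : ℕ} [NeZero M] {u w : ℕ} (hu : 2 ^ (u + 1) ∣ M)
    (hw : 2 ^ (w + 1) ∣ M) (r : ZMod M) (x c : ℤ)
    (hx : x = 2 ^ u * (2 * c + 1) ∨ x = 2 ^ w * (2 * c + 1)) :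
    digitColor u w (r + (x : ZMod M)) ≠ digitColor u w r := by
  intro h
  have h' := congrArg Fin.val h
  simp only [digitColor] at h'
  rcases hx with hx | hx
  · have := digit_add_ne hu r x c hx
    omega
  · have := digit_add_ne hw r x c hx
    omega

/-! ### The tables of diagonals and shifts -/

/-- The integer combination of `K`, `L`, `H` with the given coefficients. -/
def lincomb (K L H : ℤ) (t : ℤ × ℤ × ℤ) : ℤ := t.1 * K + t.2.1 * L + t.2.2 * H

theorem lincomb_sub (K L H : ℤ) (t t' : ℤ × ℤ × ℤ) :
    lincomb K L H (t - t') = lincomb K L H t - lincomb K L H t' := by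
  simp only [lincomb, Prod.fst_sub, Prod.snd_sub]
  ring

/-- Coefficients whose combination has the 2-adic valuation of `K` or of `L`. -/
def Separating (t : ℤ × ℤ × ℤ) : Prop := t.1 % 2 = 1 ∨ t.1 = 0 ∧ t.2.1 % 2 = 1

instance : DecidablePred Separating := fun t => by unfold Separating; infer_instance

/-- Coefficients whose combination does not vanish modulo `M`, provided those with coefficients
`(2, -1, -x)` and `(2, 1, -z)` do not vanish. -/
def Nonvanishing (x z : ℤ) (t : ℤ × ℤ × ℤ) : Prop :=
  Separating t ∨ (t.1 = 2 ∨ t.1 = -2) ∧ t.2.1 = 0 ∨ t.1 = 0 ∧ t.2.1 = 0 ∧ t.2.2 % 2 = 1 ∨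
    t = (2, -1, -x) ∨ t = (-2, 1, x) ∨ t = (2, 1, -z) ∨ t = (-2, -1, z)

instance (x z : ℤ) : DecidablePred (Nonvanishing x z) := fun t => by
  unfold Nonvanishing; infer_instance

section Table

variable {n p q : ℕ} {K L : ℤ}

/-- The valuations of K, L and H are p < q < n, so the first term with odd coefficient decides: K,
or L when K is absent. -/
theorem lincomb_valuation (hpq : p < q) (hqn : q < n) {a b : ℤ}
    (hK : K = 2 ^ p * (2 * a + 1)) (hL : L = 2 ^ q * (2 * b + 1)) {t : ℤ × ℤ × ℤ}
    (ht : Separating t) :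
    (∃ c, lincomb K L (2 ^ n) t = 2 ^ p * (2 * c + 1)) ∨
      ∃ c, lincomb K L (2 ^ n) t = 2 ^ q * (2 * c + 1) := by
  obtain ⟨i, rfl⟩ : ∃ i, q = p + 1 + i := ⟨q - p - 1, by omega⟩
  obtain ⟨j, rfl⟩ : ∃ j, n = p + 1 + i + 1 + j := ⟨n - (p + 1 + i) - 1, by omega⟩
  obtain ⟨α, β, γ⟩ := t
  rcases ht with h | ⟨h0, h⟩
  · left
    obtain ⟨c, hc⟩ : ∃ c, α = 2 * c + 1 := ⟨α / 2, by simp only at h; omega⟩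
    refine ⟨c + a + 2 * a * c + β * 2 ^ i * (2 * b + 1) + γ * 2 ^ (i + 1 + j), ?_⟩
    simp only [lincomb, hK, hL, hc]
    ring
  · right
    simp only at h0 h
    obtain ⟨c, hc⟩ : ∃ c, β = 2 * c + 1 := ⟨β / 2, by omega⟩
    refine ⟨c + b + 2 * b * c + γ * 2 ^ j, ?_⟩
    simp only [lincomb, hL, hc, h0]
    ring

theorem two_pow_mul_odd_ne_zero {M r : ℕ} (hM : 2 ^ (r + 1) ∣ M) (c : ℤ) :
    ((2 ^ r * (2 * c + 1) : ℤ) : ZMod M) ≠ 0 := by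
  rw [Ne, ZMod.intCast_zmod_eq_zero_iff_dvd]
  intro h
  have h1 : ((2 : ℤ) ^ (r + 1)) ∣ (M : ℤ) := by exact_mod_cast hM
  obtain ⟨z, hz⟩ := h1.trans h
  rw [pow_succ, mul_assoc] at hz
  have := mul_left_cancel₀ (by positivity : (2 : ℤ) ^ r ≠ 0) hz
  omega

/-- Apart from the two exceptional vectors and their negatives, the valuation is p, q, p + 1 or n,
always below n + 1. For ±2K + γH this uses p + 1 < n. -/
theorem lincomb_ne_zero (hpq : p < q) (hqn : q < n) {a b : ℤ}
    (hK : K = 2 ^ p * (2 * a + 1)) (hL : L = 2 ^ q * (2 * b + 1)) {x z : ℤ}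
    (hx : (lincomb K L (2 ^ n) (2, -1, -x) : ZMod (2 ^ (n + 1))) ≠ 0)
    (hz : (lincomb K L (2 ^ n) (2, 1, -z) : ZMod (2 ^ (n + 1))) ≠ 0) {t : ℤ × ℤ × ℤ}
    (ht : Nonvanishing x z t) :
    (lincomb K L (2 ^ n) t : ZMod (2 ^ (n + 1))) ≠ 0 := by
  have hdvd (r : ℕ) (hr : r ≤ n) : 2 ^ (r + 1) ∣ 2 ^ (n + 1) := pow_dvd_pow 2 (by omega)
  rcases ht with h | ⟨h1, h2⟩ | ⟨h1, h2, h3⟩ | h | h | h | h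
  · rcases lincomb_valuation hpq hqn hK hL h with ⟨c, hc⟩ | ⟨c, hc⟩
    · rw [hc]; exact two_pow_mul_odd_ne_zero (hdvd p (by omega)) c
    · rw [hc]; exact two_pow_mul_odd_ne_zero (hdvd q (by omega)) c
  · obtain ⟨j, hj⟩ : ∃ j, n = p + 1 + 1 + j := ⟨n - (p + 1) - 1, by omega⟩
    obtain ⟨α, β, γ⟩ := t
    simp only at h1 h2
    have : ∃ c, lincomb K L (2 ^ n) (α, β, γ) = 2 ^ (p + 1) * (2 * c + 1) := by
      rcases h1 with h1 | h1
      · refine ⟨a + γ * 2 ^ j, ?_⟩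
        simp only [lincomb, h1, h2, hK, hj]
        ring
      · refine ⟨-a - 1 + γ * 2 ^ j, ?_⟩
        simp only [lincomb, h1, h2, hK, hj]
        ring
    obtain ⟨c, hc⟩ := this
    rw [hc]; exact two_pow_mul_odd_ne_zero (hdvd (p + 1) (by omega)) c
  · have : lincomb K L (2 ^ n) t = 2 ^ n * (2 * (t.2.2 / 2) + 1) := by
      simp only [lincomb, h1, h2]
      rw [show 2 * (t.2.2 / 2) + 1 = t.2.2 by omega]
      ring
    rw [this]; exact two_pow_mul_odd_ne_zero (hdvd n le_rfl) _
  · rw [h]; exact hx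
  · rw [h, show lincomb K L (2 ^ n) (-2, 1, x) = -lincomb K L (2 ^ n) (2, -1, -x) by
      simp only [lincomb]; ring, Int.cast_neg, neg_ne_zero]
    exact hx
  · rw [h]; exact hz
  · rw [h, show lincomb K L (2 ^ n) (-2, -1, z) = -lincomb K L (2 ^ n) (2, 1, -z) by
      simp only [lincomb]; ring, Int.cast_neg, neg_ne_zero]
    exact hz

/-- The candidates for x = 0 and x = 1 differ by H, which is nonzero modulo 2H. This handles 2K ± L,
which may vanish when q = p + 1. -/
theorem exists_shift (t₁ t₂ : ℤ) :
    ∃ x : ℤ, (x = 0 ∨ x = 1) ∧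
      (lincomb K L (2 ^ n) (t₁, t₂, -x) : ZMod (2 ^ (n + 1))) ≠ 0 := by
  by_cases h : (lincomb K L (2 ^ n) (t₁, t₂, 0) : ZMod (2 ^ (n + 1))) = 0
  · refine ⟨1, Or.inr rfl, fun h' => ?_⟩
    refine two_pow_mul_odd_ne_zero (r := n) (M := 2 ^ (n + 1)) dvd_rfl 0 ?_
    have : (2 ^ n * (2 * 0 + 1) : ℤ)
        = lincomb K L (2 ^ n) (t₁, t₂, 0) - lincomb K L (2 ^ n) (t₁, t₂, -1) := by
      simp only [lincomb]; ring
    rw [this, Int.cast_sub, h, h', sub_zero]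
  · exact ⟨0, Or.inl rfl, by simpa using h⟩

/-- A table of diagonals and shifts with the required differences gives a Latin square. -/
theorem exists_latinSquare_of_table (hpq : p < q) (hqn : q < n) {a b : ℤ}
    (hK : K = 2 ^ p * (2 * a + 1)) (hL : L = 2 ^ q * (2 * b + 1)) {x z : ℤ}
    (hx : (lincomb K L (2 ^ n) (2, -1, -x) : ZMod (2 ^ (n + 1))) ≠ 0)
    (hz : (lincomb K L (2 ^ n) (2, 1, -z) : ZMod (2 ^ (n + 1))) ≠ 0)
    {u w : ℕ} (huw : u = p ∧ w = q ∨ u = q ∧ w = p)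
    (D σ : Fin 2 × Fin 4 → ℤ × ℤ × ℤ) (hD : ∀ i j, i ≠ j → Nonvanishing x z (D i - D j))
    (hrow : ∀ t i j, i ≠ j → Separating (σ (t, i) - σ (t, j)))
    (hcol : ∀ t i j, i ≠ j → Separating (σ (t, i) - D (t, i) - (σ (t, j) - D (t, j))))
    (o : ZMod (2 ^ (n + 1))) :
    ∃ f : ZMod (2 ^ (n + 1)) → ZMod (2 ^ (n + 1)) → ℕ, IsLatinSquare (2 ^ (n + 1)) f ∧
      ∀ i r, f r (r + (o + lincomb K L (2 ^ n) (D i)))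
        = 4 * (i.1 : ℕ) + digitColor (M := 2 ^ (n + 1)) u w (r + lincomb K L (2 ^ n) (σ i)) + 1 := by
  have hdvd (r : ℕ) (hr : r ≤ n) : 2 ^ (r + 1) ∣ 2 ^ (n + 1) := pow_dvd_pow 2 (by omega)
  have hsep (t t' : ℤ × ℤ × ℤ) (ht : Separating (t - t')) (r : ZMod (2 ^ (n + 1))) :
      digitColor (M := 2 ^ (n + 1)) u w (r + lincomb K L (2 ^ n) t) ≠
        digitColor (M := 2 ^ (n + 1)) u w (r + lincomb K L (2 ^ n) t') := by
    have hr : r + (lincomb K L (2 ^ n) t : ZMod (2 ^ (n + 1)))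
        = (r + lincomb K L (2 ^ n) t') + (lincomb K L (2 ^ n) (t - t') : ℤ) := by
      rw [lincomb_sub]; push_cast; ring
    rw [hr]
    have hv := lincomb_valuation hpq hqn hK hL ht
    rcases huw with ⟨rfl, rfl⟩ | ⟨rfl, rfl⟩
    · rcases hv with ⟨c, hc⟩ | ⟨c, hc⟩
      · exact digitColor_add_ne (hdvd _ (by omega)) (hdvd _ (by omega)) _ _ c (Or.inl hc)
      · exact digitColor_add_ne (hdvd _ (by omega)) (hdvd _ (by omega)) _ _ c (Or.inr hc)
    · rcases hv with ⟨c, hc⟩ | ⟨c, hc⟩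
      · exact digitColor_add_ne (hdvd _ (by omega)) (hdvd _ (by omega)) _ _ c (Or.inr hc)
      · exact digitColor_add_ne (hdvd _ (by omega)) (hdvd _ (by omega)) _ _ c (Or.inl hc)
  refine exists_latinSquare_of_diagonals (digitColor (M := 2 ^ (n + 1)) u w)
    (fun i => o + lincomb K L (2 ^ n) (D i))
    (fun i => (lincomb K L (2 ^ n) (σ i) : ZMod (2 ^ (n + 1)))) ?_ ?_ ?_
  · intro i j hij
    by_contra hne
    refine lincomb_ne_zero hpq hqn hK hL hx hz (hD i j hne) ?_
    rw [lincomb_sub, Int.cast_sub, sub_eq_zero]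
    exact add_left_cancel hij
  · intro t i j hij r
    exact hsep _ _ (hrow t i j hij) r
  · intro t i j hij c
    have := hsep _ _ (hcol t i j hij) (c - o)
    rw [lincomb_sub, lincomb_sub] at this
    push_cast at this
    rw [sub_add_eq_add_sub, sub_add_eq_add_sub] at this
    convert this using 2 <;> ring

/-- The completed square when `k` has a smaller 2-adic valuation than `l`. -/
theorem exists_latinSquare_of_lt (hpq : p < q) (hqn : q < n) {a b : ℤ}
    (hK : K = 2 ^ p * (2 * a + 1)) (hL : L = 2 ^ q * (2 * b + 1))
    {u w : ℕ} (huw : u = p ∧ w = q ∨ u = q ∧ w = p) (o : ZMod (2 ^ (n + 1))) :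
    ∃ f : ZMod (2 ^ (n + 1)) → ZMod (2 ^ (n + 1)) → ℕ, IsLatinSquare (2 ^ (n + 1)) f ∧
      ∀ r, f r (r + o) = digitColor u w r + 1 ∧
        f r (r + (o + K - L)) = digitColor (M := 2 ^ (n + 1)) u w (r + K) + 1 ∧
        f r (r + (o - L + 2 ^ n)) = 4 + digitColor u w r + 1 ∧
        f r (r + (o + K + 2 ^ n)) = 4 + digitColor (M := 2 ^ (n + 1)) u w (r + K) + 1 := by
  obtain ⟨x, hx, hx'⟩ := exists_shift (n := n) (K := K) (L := L) 2 (-1)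
  obtain ⟨z, hz, hz'⟩ := exists_shift (n := n) (K := K) (L := L) 2 1
  -- In each group, entries 0 and 1 are the prescribed diagonals and entries 2 and 3 the added ones.
  -- The corrections x and z keep entries 1 and 2 on distinct diagonals; once they are fixed, all
  -- conditions concern explicit integers.
  obtain ⟨f, hf, hfD⟩ := exists_latinSquare_of_table hpq hqn hK hL hx' hz' huw
    (fun i => (![![(0, 0, 0), (1, -1, 0), (-1, 0, x), (0, -1, 0)],
      ![(0, -1, 1), (1, 0, 1), (-1, -1, 1 + z), (0, 0, 1)]] : Fin 2 → Fin 4 → ℤ × ℤ × ℤ) i.1 i.2)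
    (fun i => (![![(0, 0, 0), (1, 0, 0), (0, 1, x), (1, -1, 0)],
      ![(0, 0, 0), (1, 0, 0), (0, -1, z), (1, 1, 0)]] : Fin 2 → Fin 4 → ℤ × ℤ × ℤ) i.1 i.2)
    (by rcases hx with rfl | rfl <;> rcases hz with rfl | rfl <;> decide)
    (by rcases hx with rfl | rfl <;> rcases hz with rfl | rfl <;> decide)
    (by rcases hx with rfl | rfl <;> rcases hz with rfl | rfl <;> decide) o
  refine ⟨f, hf, fun r => ⟨?_, ?_, ?_, ?_⟩⟩
  · simpa [lincomb] using hfD (0, 0) r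
  · have := hfD (0, 1) r
    simp [lincomb] at this
    rw [← this]; congr 1; ring
  · have := hfD (1, 0) r
    simp [lincomb] at this
    rw [← this]; congr 1; ring
  · have := hfD (1, 1) r
    simp [lincomb] at this
    rw [← this]; congr 1; ring

/-- The completed square when `k` has a larger 2-adic valuation than `l`. -/
theorem exists_latinSquare_of_gt (hpq : p < q) (hqn : q < n) {a b : ℤ}
    (hK : K = 2 ^ p * (2 * a + 1)) (hL : L = 2 ^ q * (2 * b + 1))
    {u w : ℕ} (huw : u = p ∧ w = q ∨ u = q ∧ w = p) (o : ZMod (2 ^ (n + 1))) :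
    ∃ f : ZMod (2 ^ (n + 1)) → ZMod (2 ^ (n + 1)) → ℕ, IsLatinSquare (2 ^ (n + 1)) f ∧
      ∀ r, f r (r + o) = digitColor u w r + 1 ∧
        f r (r + (o + L - K)) = digitColor (M := 2 ^ (n + 1)) u w (r + L) + 1 ∧
        f r (r + (o - K + 2 ^ n)) = 4 + digitColor u w r + 1 ∧
        f r (r + (o + L + 2 ^ n)) = 4 + digitColor (M := 2 ^ (n + 1)) u w (r + L) + 1 := by
  obtain ⟨x, hx, hx'⟩ := exists_shift (n := n) (K := K) (L := L) 2 (-1)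
  obtain ⟨z, hz, hz'⟩ := exists_shift (n := n) (K := K) (L := L) 2 1
  -- K still denotes the parameter of smaller valuation, so it stands for l here and L for k. The
  -- prescribed shift is therefore L.
  obtain ⟨f, hf, hfD⟩ := exists_latinSquare_of_table hpq hqn hK hL hx' hz' huw
    (fun i => (![![(0, 0, 0), (-1, 1, 0), (1, 0, -x), (0, 1, 0)],
      ![(-1, 0, 1), (0, 1, 1), (1, 1, 1 - z), (0, 0, 1)]] : Fin 2 → Fin 4 → ℤ × ℤ × ℤ) i.1 i.2)
    (fun i => (![![(0, 0, 0), (0, 1, 0), (1, 1, 0), (1, 0, 0)],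
      ![(0, 0, 0), (0, 1, 0), (1, 0, 0), (1, 1, 0)]] : Fin 2 → Fin 4 → ℤ × ℤ × ℤ) i.1 i.2)
    (by rcases hx with rfl | rfl <;> rcases hz with rfl | rfl <;> decide)
    (by rcases hx with rfl | rfl <;> rcases hz with rfl | rfl <;> decide)
    (by rcases hx with rfl | rfl <;> rcases hz with rfl | rfl <;> decide) o
  refine ⟨f, hf, fun r => ⟨?_, ?_, ?_, ?_⟩⟩
  · simpa [lincomb] using hfD (0, 0) r
  · have := hfD (0, 1) r
    simp [lincomb] at this
    rw [← this]; congr 1; ring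
  · have := hfD (1, 0) r
    simp [lincomb] at this
    rw [← this]; congr 1; ring
  · have := hfD (1, 1) r
    simp [lincomb] at this
    rw [← this]; congr 1; ring

end Table

/-! ### Colour classes as digit conditions -/

/-- With zero-based i and t, the index is r = t 2^(m₂+1) + i 2^m₁ + c with c < 2^m₁. Its digit at m₁
is the parity of i, and its digit at m₂ tells in which half of the range i lies. -/
theorem mem_blockUnion2_iff {lam m₁ m₂ : ℕ} (h12 : m₁ < m₂) (h2 : m₂ < lam) (off v i₂ : ℕ)
    (parity : ℕ → Prop) (i₁ : ℕ) (hpar : ∀ i, parity (i + 1) ↔ i % 2 = i₁) (hi₂ : i₂ < 2) :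
    v ∈ blockUnion2 lam m₁ m₂ off (i₂ * 2 ^ (m₂ - m₁) + 1) ((i₂ + 1) * 2 ^ (m₂ - m₁)) parity ↔
      ∃ r < 2 ^ lam, v = off + r + 1 ∧ r / 2 ^ m₁ % 2 = i₁ ∧ r / 2 ^ m₂ % 2 = i₂ := by
  obtain ⟨d, rfl⟩ : ∃ d, m₂ = m₁ + d := ⟨m₂ - m₁, by omega⟩
  obtain ⟨j, rfl⟩ : ∃ j, lam = m₁ + d + 1 + j := ⟨lam - (m₁ + d) - 1, by omega⟩
  rw [show m₁ + d - m₁ = d by omega]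
  have hd : 1 ≤ d := by omega
  obtain ⟨d', rfl⟩ : ∃ d', d = d' + 1 := ⟨d - 1, by omega⟩
  constructor
  · rintro ⟨i, t, hlo, hhi, hp, ht, ht', hv⟩
    rw [show m₁ + (d' + 1) + 1 + j - (m₁ + (d' + 1)) - 1 = j by omega] at ht'
    obtain ⟨i, rfl⟩ : ∃ i', i = i' + 1 := ⟨i - 1, by omega⟩
    obtain ⟨t, rfl⟩ : ∃ t', t = t' + 1 := ⟨t - 1, by omega⟩
    simp only [block2, Nat.add_sub_cancel, Set.mem_Icc] at hv
    rw [hpar] at hp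
    obtain ⟨c, hc⟩ : ∃ c, v = off + (t * 2 ^ (m₁ + (d' + 1) + 1) + i * 2 ^ m₁ + c) + 1 :=
      ⟨v - (off + t * 2 ^ (m₁ + (d' + 1) + 1) + i * 2 ^ m₁ + 1), by omega⟩
    have hc' : c < 2 ^ m₁ := by
      have := hv.2
      rw [Nat.add_mul] at this
      omega
    have hr1 : (t * 2 ^ (m₁ + (d' + 1) + 1) + i * 2 ^ m₁ + c) / 2 ^ m₁
        = t * 2 ^ (d' + 2) + i := by
      rw [show t * 2 ^ (m₁ + (d' + 1) + 1) + i * 2 ^ m₁ + c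
        = c + 2 ^ m₁ * (t * 2 ^ (d' + 2) + i) by ring,
        Nat.add_mul_div_left _ _ (by positivity), Nat.div_eq_of_lt hc', zero_add]
    have hr2 : (t * 2 ^ (m₁ + (d' + 1) + 1) + i * 2 ^ m₁ + c) / 2 ^ (m₁ + (d' + 1))
        = 2 * t + i₂ := by
      rw [pow_add 2 m₁ (d' + 1), ← Nat.div_div_eq_div_mul, hr1]
      rw [add_mul] at hhi
      obtain ⟨i', rfl⟩ : ∃ i', i = i₂ * 2 ^ (d' + 1) + i' := ⟨i - i₂ * 2 ^ (d' + 1), by omega⟩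
      rw [show t * 2 ^ (d' + 2) + (i₂ * 2 ^ (d' + 1) + i')
        = i' + 2 ^ (d' + 1) * (2 * t + i₂) by ring,
        Nat.add_mul_div_left _ _ (by positivity), Nat.div_eq_of_lt (by omega), zero_add]
    refine ⟨_, ?_, hc, ?_, ?_⟩
    · rw [pow_add 2 (m₁ + (d' + 1) + 1) j, mul_comm (2 ^ (m₁ + (d' + 1) + 1)) (2 ^ j),
        ← Nat.div_lt_iff_lt_mul (by positivity)]
      have hq : ∀ y, y / 2 ^ (m₁ + (d' + 1) + 1) = y / 2 ^ (m₁ + (d' + 1)) / 2 := fun y => by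
        rw [Nat.div_div_eq_div_mul, ← pow_succ]
      rw [hq, hr2]
      omega
    · rw [hr1, show t * 2 ^ (d' + 2) + i = i + 2 * (t * 2 ^ (d' + 1)) by ring]
      omega
    · rw [hr2]; omega
  · rintro ⟨r, hr, rfl, h1, h2'⟩
    obtain ⟨A, hA⟩ : ∃ A, A = r / 2 ^ m₁ := ⟨_, rfl⟩
    obtain ⟨T, hT⟩ : ∃ T, T = A / 2 ^ (d' + 2) := ⟨_, rfl⟩
    have hB : r / 2 ^ (m₁ + (d' + 1)) = A / 2 ^ (d' + 1) := by
      rw [pow_add, ← Nat.div_div_eq_div_mul, hA]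
    have hBT : A / 2 ^ (d' + 1) = 2 * T + i₂ := by
      have : T = A / 2 ^ (d' + 1) / 2 := by
        rw [hT, Nat.div_div_eq_div_mul, ← pow_succ]
      rw [hB] at h2'
      omega
    have hA1 := Nat.div_add_mod A (2 ^ (d' + 1))
    have hA2 := Nat.mod_lt A (show 0 < 2 ^ (d' + 1) by positivity)
    have hr1 := Nat.div_add_mod r (2 ^ m₁)
    have hr2 := Nat.mod_lt r (show 0 < 2 ^ m₁ by positivity)
    rw [hBT] at hA1
    rw [← hA] at hr1 h1
    refine ⟨i₂ * 2 ^ (d' + 1) + A % 2 ^ (d' + 1) + 1, T + 1, by omega, ?_, ?_, by omega, ?_, ?_⟩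
    · rw [add_mul]; omega
    · have e : 2 ^ (d' + 1) * (2 * T + i₂) = i₂ * 2 ^ (d' + 1) + 2 * (T * 2 ^ (d' + 1)) := by ring
      rw [hpar]
      omega
    · rw [show m₁ + (d' + 1) + 1 + j - (m₁ + (d' + 1)) - 1 = j by omega, Nat.succ_le_iff, hT, hA,
        Nat.div_div_eq_div_mul, ← pow_add, Nat.div_lt_iff_lt_mul (by positivity), ← pow_add,
        show j + (m₁ + (d' + 2)) = m₁ + (d' + 1) + 1 + j by ring]
      exact hr
    · simp only [block2, Nat.add_sub_cancel, Set.mem_Icc]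
      have e : T * 2 ^ (m₁ + (d' + 1) + 1) + (i₂ * 2 ^ (d' + 1) + A % 2 ^ (d' + 1)) * 2 ^ m₁
          = 2 ^ m₁ * A := by
        conv_rhs => rw [← hA1]
        ring
      have e' : (i₂ * 2 ^ (d' + 1) + A % 2 ^ (d' + 1) + 1) * 2 ^ m₁
          = (i₂ * 2 ^ (d' + 1) + A % 2 ^ (d' + 1)) * 2 ^ m₁ + 2 ^ m₁ := by ring
      rw [e']
      omega

/-- With zero-based i, the index is r = i 2^m + i₂ + 2t inside its block, so digit m is the parity
of i and digit 0 is i₂. -/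
theorem mem_blockUnion1_iff {lam m : ℕ} (hm : 1 ≤ m) (hml : m < lam) (off v i₂ : ℕ)
    (parity : ℕ → Prop) (i₁ : ℕ) (hpar : ∀ i, parity (i + 1) ↔ i % 2 = i₁) (hi₂ : i₂ < 2) :
    v ∈ blockUnion1 lam m off (i₂ + 1) parity ↔
      ∃ r < 2 ^ lam, v = off + r + 1 ∧ r / 2 ^ m % 2 = i₁ ∧ r / 2 ^ 0 % 2 = i₂ := by
  obtain ⟨j, rfl⟩ : ∃ j, lam = m + j := ⟨lam - m, by omega⟩
  obtain ⟨m', rfl⟩ : ∃ m', m = m' + 1 := ⟨m - 1, by omega⟩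
  rw [pow_zero]
  simp only [Nat.div_one]
  constructor
  · rintro ⟨i, hi, hi', hp, t, hv, hv'⟩
    rw [Nat.add_sub_cancel_left] at hi'
    obtain ⟨i, rfl⟩ : ∃ i', i = i' + 1 := ⟨i - 1, by omega⟩
    rw [Nat.add_sub_cancel] at hv
    rw [hpar] at hp
    rw [add_mul] at hv'
    have hr : (i * 2 ^ (m' + 1) + i₂ + 2 * t) / 2 ^ (m' + 1) = i := by
      rw [show i * 2 ^ (m' + 1) + i₂ + 2 * t = (i₂ + 2 * t) + 2 ^ (m' + 1) * i by ring,
        Nat.add_mul_div_left _ _ (by positivity), Nat.div_eq_of_lt (by omega), zero_add]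
    refine ⟨i * 2 ^ (m' + 1) + i₂ + 2 * t, ?_, by omega, by rw [hr, hp], ?_⟩
    · rw [pow_add 2 (m' + 1) j, mul_comm (2 ^ (m' + 1)) (2 ^ j),
        ← Nat.div_lt_iff_lt_mul (by positivity), hr]
      omega
    · rw [show i * 2 ^ (m' + 1) + i₂ + 2 * t = i₂ + 2 * (i * 2 ^ m' + t) by ring]
      omega
  · rintro ⟨r, hr, rfl, h1, h2⟩
    have hr1 := Nat.div_add_mod r (2 ^ (m' + 1))
    have hr2 := Nat.mod_lt r (show 0 < 2 ^ (m' + 1) by positivity)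
    have hr3 : r % 2 ^ (m' + 1) % 2 = i₂ := by
      rw [Nat.mod_mod_of_dvd _ (dvd_pow_self 2 (by omega)), h2]
    have hr4 : r / 2 ^ (m' + 1) * 2 ^ (m' + 1) = 2 ^ (m' + 1) * (r / 2 ^ (m' + 1)) := by ring
    refine ⟨r / 2 ^ (m' + 1) + 1, Nat.le_add_left _ _, ?_, by rw [hpar, h1],
      r % 2 ^ (m' + 1) / 2, ?_, ?_⟩
    · rw [Nat.add_sub_cancel_left, Nat.succ_le_iff, Nat.div_lt_iff_lt_mul (by positivity),
        ← pow_add, add_comm j]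
      exact hr
    · rw [Nat.add_sub_cancel, hr4]
      omega
    · rw [add_mul, hr4]
      omega

/-- The labels of colour `q`: the family is `q / 4` and the binary digits of the index at the
positions `u` and `w` are those of `q % 4`. -/
def digitClass (lam u w : ℕ) (q : Fin 8) : Set ℕ :=
  {v | ∃ r < 2 ^ lam, v = (q : ℕ) / 4 * 2 ^ lam + r + 1 ∧ r / 2 ^ u % 2 = (q : ℕ) % 4 % 2 ∧
    r / 2 ^ w % 2 = (q : ℕ) % 4 / 2}

theorem odd_succ_iff (i : ℕ) : Odd (i + 1) ↔ i % 2 = 0 := by rw [Nat.odd_iff]; omega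

theorem even_succ_iff (i : ℕ) : Even (i + 1) ↔ i % 2 = 1 := by rw [Nat.even_iff]; omega

theorem evenClasses_eq {lam m₁ m₂ : ℕ} (h12 : m₁ < m₂) (h2 : m₂ < lam) :
    evenClasses lam m₁ m₂ = digitClass lam m₁ m₂ := by
  have hodd (off v i₂ : ℕ) := mem_blockUnion2_iff h12 h2 off v i₂ Odd 0 odd_succ_iff
  have heven (off v i₂ : ℕ) := mem_blockUnion2_iff h12 h2 off v i₂ Even 1 even_succ_iff
  have h20 : 2 ^ (m₂ - m₁ + 1) = (1 + 1) * 2 ^ (m₂ - m₁) := by ring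
  funext q
  ext v
  have o0 := hodd 0 v 0 (by omega)
  have o1 := hodd 0 v 1 (by omega)
  have o2 := hodd (2 ^ lam) v 0 (by omega)
  have o3 := hodd (2 ^ lam) v 1 (by omega)
  have e0 := heven 0 v 0 (by omega)
  have e1 := heven 0 v 1 (by omega)
  have e2 := heven (2 ^ lam) v 0 (by omega)
  have e3 := heven (2 ^ lam) v 1 (by omega)
  simp only [zero_mul, zero_add, one_mul] at o0 o1 o2 o3 e0 e1 e2 e3
  fin_cases q <;> simp [evenClasses, digitClass, h20] <;> assumption

theorem mixedClasses_eq {lam m : ℕ} (hm : 1 ≤ m) (hml : m < lam) :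
    mixedClasses lam m = digitClass lam m 0 := by
  have hodd (off v i₂ : ℕ) := mem_blockUnion1_iff hm hml off v i₂ Odd 0 odd_succ_iff
  have heven (off v i₂ : ℕ) := mem_blockUnion1_iff hm hml off v i₂ Even 1 even_succ_iff
  funext q
  ext v
  have o0 := hodd 0 v 0 (by omega)
  have o1 := hodd 0 v 1 (by omega)
  have o2 := hodd (2 ^ lam) v 0 (by omega)
  have o3 := hodd (2 ^ lam) v 1 (by omega)
  have e0 := heven 0 v 0 (by omega)
  have e1 := heven 0 v 1 (by omega)
  have e2 := heven (2 ^ lam) v 0 (by omega)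
  have e3 := heven (2 ^ lam) v 1 (by omega)
  simp only [zero_add, pow_zero, Nat.div_one] at o0 o1 o2 o3 e0 e1 e2 e3
  fin_cases q <;> simp [mixedClasses, digitClass] <;> assumption

/-! ### Labels of vertices and their colours -/

/-- The family and the index of a label. -/
def labelIndex (M v : ℕ) : Bool × ZMod M :=
  if v ≤ M then (false, ((v - 1 : ℕ) : ZMod M)) else (true, ((v - M - 1 : ℕ) : ZMod M))

theorem labelIndex_eq {M v : ℕ} (t : Bool) (r : ℕ) (hr : r < M) (hv : v = t.toNat * M + r + 1) :
    labelIndex M v = (t, (r : ZMod M)) := by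
  subst hv
  cases t
  · simp [labelIndex, Nat.succ_le_iff.2 hr]
  · have h1 : ¬ M + r + 1 ≤ M := by omega
    have h2 : M + r + 1 - M - 1 = r := by omega
    simp [labelIndex, h1, h2]

theorem exists_label_form {M v : ℕ} (hv : v ∈ Set.Icc 1 (2 * M)) :
    ∃ (t : Bool) (r : ℕ), r < M ∧ v = t.toNat * M + r + 1 := by
  obtain ⟨h1, h2⟩ := hv
  by_cases h : v ≤ M
  · exact ⟨false, v - 1, by omega, by simp; omega⟩
  · exact ⟨true, v - M - 1, by omega, by simp; omega⟩

theorem bijOn_labelIndex (M : ℕ) [NeZero M] :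
    Set.BijOn (labelIndex M) (Set.Icc 1 (2 * M)) Set.univ := by
  refine ⟨fun _ _ => Set.mem_univ _, ?_, ?_⟩
  · intro v hv v' hv' h
    obtain ⟨t, r, hr, hv⟩ := exists_label_form hv
    obtain ⟨t', r', hr', hv'⟩ := exists_label_form hv'
    rw [labelIndex_eq t r hr hv, labelIndex_eq t' r' hr' hv', Prod.mk.injEq] at h
    have h2 := congrArg ZMod.val h.2
    rw [ZMod.val_natCast_of_lt hr, ZMod.val_natCast_of_lt hr'] at h2
    rw [hv, hv', h.1, h2]
  · rintro ⟨t, i⟩ -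
    have hi := ZMod.val_lt i
    refine ⟨t.toNat * M + i.val + 1, ?_, ?_⟩
    · cases t <;> simp <;> omega
    · rw [labelIndex_eq t i.val hi rfl, ZMod.natCast_zmod_val]

/-- The colour of a vertex of the vital graph. -/
def vertexColor {M : ℕ} (u w : ℕ) (j : Bool × ZMod M) : Fin 8 :=
  ⟨4 * j.1.toNat + digitColor u w j.2, by
    have := Bool.toNat_lt j.1
    have := (digitColor u w j.2).2
    omega⟩

theorem vertexColor_labelIndex_iff {n u w v : ℕ} (hv : v ∈ Set.Icc 1 (2 * 2 ^ n)) (q : Fin 8) :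
    vertexColor u w (labelIndex (2 ^ n) v) = q ↔ v ∈ digitClass n u w q := by
  obtain ⟨t, r, hr, hv⟩ := exists_label_form hv
  rw [labelIndex_eq t r hr hv, Fin.ext_iff]
  simp only [vertexColor, digitColor, digitClass, Set.mem_ofPred_eq, ZMod.val_natCast_of_lt hr]
  have hq := q.2
  constructor
  · intro h
    have hq4 : (q : ℕ) / 4 = t.toNat := by omega
    exact ⟨r, hr, by rw [hq4, hv], by omega, by omega⟩
  · rintro ⟨r', hr', hv', h1, h2⟩
    have hq4 : (q : ℕ) / 4 = 0 ∨ (q : ℕ) / 4 = 1 := by omega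
    have hrr : r = r' ∧ t.toNat = (q : ℕ) / 4 := by
      rcases hq4 with h | h <;> rw [h] at hv' <;> cases t <;> simp at hv ⊢ <;> omega
    obtain ⟨rfl, ht⟩ := hrr
    rw [ht, h1, h2]
    omega

/-! ### The two-cell classes in the square -/

theorem natCast_half_add_half {n : ℕ} : ((2 ^ n : ℕ) : ZMod (2 ^ (n + 1))) + (2 ^ n : ℕ) = 0 := by
  rw [← Nat.cast_add, ← two_mul, mul_comm, ← pow_succ, ZMod.natCast_self]

theorem natCast_ne {n a b : ℕ} (ha : a < 2 ^ (n + 1)) (hb : b < 2 ^ (n + 1)) (hab : a ≠ b) :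
    (a : ZMod (2 ^ (n + 1))) ≠ b := by
  intro h
  have := congrArg ZMod.val h
  rw [ZMod.val_natCast_of_lt ha, ZMod.val_natCast_of_lt hb] at this
  exact hab this

theorem two_le_card_cellPair {n k l : ℕ} (hk : 1 ≤ k) (hkn : k < 2 ^ n) (h : ZMod (2 ^ (n + 1)))
    (j : Bool × ZMod (2 ^ (n + 1))) :
    2 ≤ (cellPair (k : ZMod (2 ^ (n + 1))) l (2 ^ n : ℕ) h j).card := by
  have hpow : 2 ^ (n + 1) = 2 * 2 ^ n := by ring
  have hk0 : (k : ZMod (2 ^ (n + 1))) ≠ 0 := by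
    rw [← Nat.cast_zero]
    exact natCast_ne (by omega) (by omega) (by omega)
  have hne : j.2 ≠ j.2 - k := fun h => hk0 (by linear_combination h)
  unfold cellPair
  split_ifs
  · rw [Finset.card_pair fun h => hne (Prod.mk.inj h).1]
  · rw [Finset.card_pair fun h => hne (Prod.mk.inj h).1]

/-- The two kinds of cell in each family lie on four diagonals. These are distinct because k + l ≠
0, k ≠ l and k, l ≠ M/2 modulo M; the diagonal and the row then recover the class. -/
theorem cellPair_disjoint {n k l : ℕ} (hk : 1 ≤ k) (hkn : k < 2 ^ n) (hl : 1 ≤ l)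
    (hln : l < 2 ^ n) (hkl : k ≠ l) (h : ZMod (2 ^ (n + 1))) (j j' : Bool × ZMod (2 ^ (n + 1)))
    (p : ZMod (2 ^ (n + 1)) × ZMod (2 ^ (n + 1)))
    (hp : p ∈ cellPair (k : ZMod (2 ^ (n + 1))) l (2 ^ n : ℕ) h j)
    (hp' : p ∈ cellPair (k : ZMod (2 ^ (n + 1))) l (2 ^ n : ℕ) h j') : j = j' := by
  have hpow : 2 ^ (n + 1) = 2 * 2 ^ n := by ring
  have n1 : (k : ZMod (2 ^ (n + 1))) ≠ l := natCast_ne (by omega) (by omega) hkl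
  have n2 : ((k + l : ℕ) : ZMod (2 ^ (n + 1))) ≠ (0 : ℕ) :=
    natCast_ne (by omega) (by omega) (by omega)
  have n3 : (k : ZMod (2 ^ (n + 1))) ≠ (2 ^ n : ℕ) := natCast_ne (by omega) (by omega) (by omega)
  have n4 : (l : ZMod (2 ^ (n + 1))) ≠ (2 ^ n : ℕ) := natCast_ne (by omega) (by omega) (by omega)
  have hHH := natCast_half_add_half (n := n)
  generalize ((2 ^ n : ℕ) : ZMod (2 ^ (n + 1))) = H at *
  rw [Nat.cast_add, Nat.cast_zero] at n2
  obtain ⟨a, b⟩ := p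
  have key (j : Bool × ZMod (2 ^ (n + 1)))
      (hp : (a, b) ∈ cellPair (k : ZMod (2 ^ (n + 1))) l H h j) :
      j = (true, a) ∧ b - a = -h ∨ j = (true, a + k) ∧ b - a = k + l - h ∨
      j = (false, a) ∧ b - a = l - H - h ∨ j = (false, a + k) ∧ b - a = k + H - h := by
    obtain ⟨t, i⟩ := j
    cases t
    · simp only [cellPair, Bool.false_eq_true, if_false, Finset.mem_insert, Finset.mem_singleton,
        Prod.mk.injEq] at hp
      rcases hp with ⟨rfl, rfl⟩ | ⟨rfl, rfl⟩
      · exact Or.inr (Or.inr (Or.inl ⟨rfl, by ring⟩))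
      · exact Or.inr (Or.inr (Or.inr ⟨by simp, by ring⟩))
    · simp only [cellPair, if_true, Finset.mem_insert, Finset.mem_singleton,
        Prod.mk.injEq] at hp
      rcases hp with ⟨rfl, rfl⟩ | ⟨rfl, rfl⟩
      · exact Or.inl ⟨rfl, by ring⟩
      · exact Or.inr (Or.inl ⟨by simp, by ring⟩)
  rcases key j hp with ⟨rfl, e⟩ | ⟨rfl, e⟩ | ⟨rfl, e⟩ | ⟨rfl, e⟩ <;>
    rcases key j' hp' with ⟨rfl, e'⟩ | ⟨rfl, e'⟩ | ⟨rfl, e'⟩ | ⟨rfl, e'⟩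
  · rfl
  · exact absurd (by linear_combination e - e') n2
  · exact absurd (by linear_combination e - e') n4
  · exact absurd (by linear_combination e - e' - hHH) n3
  · exact absurd (by linear_combination e' - e) n2
  · rfl
  · exact absurd (by linear_combination e' - e - hHH) n3
  · exact absurd (by linear_combination e' - e) n4
  · exact absurd (by linear_combination e' - e) n4
  · exact absurd (by linear_combination e - e' - hHH) n3
  · rfl
  · exact absurd (by linear_combination e - e' - hHH) n1
  · exact absurd (by linear_combination e' - e - hHH) n3
  · exact absurd (by linear_combination e - e') n4
  · exact absurd (by linear_combination e' - e - hHH) n1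
  · rfl

theorem pskConstraint_eq_cellPair {n k l : ℕ} (e h : ℤ) (hh : 2 * h = k + e + l) {v : ℕ}
    (hv : v ∈ Set.Icc 1 (2 * 2 ^ (n + 1))) :
    pskConstraint (2 ^ (n + 1)) e k l v
      = cellPair (k : ZMod (2 ^ (n + 1))) l (2 ^ n : ℕ) h (labelIndex (2 ^ (n + 1)) v) := by
  obtain ⟨t, r, hr, hv⟩ := exists_label_form hv
  rw [labelIndex_eq t r hr hv]
  have h1 : ((k : ℤ) + e + l) / 2 = h := by omega
  have h2 : ((k : ℤ) + e - l) / 2 = h - l := by omega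
  have h3 : ((2 ^ (n + 1) : ℕ) : ℤ) / 2 = (2 ^ n : ℕ) := by
    rw [pow_succ]; push_cast; omega
  unfold pskConstraint
  rw [h1, h2, h3]
  cases t
  · have hv' : v ≤ 2 ^ (n + 1) := by simp at hv; omega
    have hi : (v : ℤ) - 1 = r := by simp at hv; omega
    rw [if_pos hv', hi]
    simp only [cellPair, Bool.false_eq_true, if_false]
    push_cast
    rw [show (r : ZMod (2 ^ (n + 1))) - 2 ^ n - (h - l) = r - 2 ^ n + l - h by ring]
  · have hv' : ¬ v ≤ 2 ^ (n + 1) := by simp at hv; omega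
    have hi : (v : ℤ) - (2 ^ (n + 1) : ℕ) - 1 = r := by simp at hv; omega
    rw [if_neg hv', hi]
    simp only [cellPair, if_true]
    push_cast
    rw [show (r : ZMod (2 ^ (n + 1))) - (h - l) = r + l - h by ring]

/-- The completed square in terms of the cells of the vital graph. -/
theorem exists_latinSquare_cellPair {n k l u w a b : ℕ} (hkn : k < 2 ^ n) (hln : l < 2 ^ n)
    (huw : u ≠ w) (hval : k = 2 ^ u * (2 * a + 1) ∧ l = 2 ^ w * (2 * b + 1) ∨
      k = 2 ^ w * (2 * a + 1) ∧ l = 2 ^ u * (2 * b + 1)) (h : ZMod (2 ^ (n + 1))) :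
    ∃ f : ZMod (2 ^ (n + 1)) → ZMod (2 ^ (n + 1)) → ℕ, IsLatinSquare (2 ^ (n + 1)) f ∧
      ∀ j, ∀ p ∈ cellPair (k : ZMod (2 ^ (n + 1))) l (2 ^ n : ℕ) h j,
        f p.1 p.2 = vertexColor u w j + 1 := by
  -- The diagonal of the first cells of the family `false`. Relative to it the other three are k -
  -- l, -l + H and k + H, using 2H = 0.
  obtain ⟨o, ho⟩ : ∃ o, o = (l : ZMod (2 ^ (n + 1))) - (2 ^ n : ℕ) - h := ⟨_, rfl⟩
  have hlt (r c : ℕ) (hc : 2 ^ r * (2 * c + 1) < 2 ^ n) : r < n := by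
    refine (Nat.pow_lt_pow_iff_right (a := 2) (by omega)).1 (lt_of_le_of_lt ?_ hc)
    exact Nat.le_mul_of_pos_right _ (by omega)
  have hex : ∃ f : ZMod (2 ^ (n + 1)) → ZMod (2 ^ (n + 1)) → ℕ, IsLatinSquare (2 ^ (n + 1)) f ∧
      ∀ r, f r (r + o) = digitColor u w r + 1 ∧
        f r (r + (o + (k : ℤ) - (l : ℤ)))
          = digitColor (M := 2 ^ (n + 1)) u w (r + (k : ℤ)) + 1 ∧
        f r (r + (o - (l : ℤ) + 2 ^ n)) = 4 + digitColor u w r + 1 ∧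
        f r (r + (o + (k : ℤ) + 2 ^ n))
          = 4 + digitColor (M := 2 ^ (n + 1)) u w (r + (k : ℤ)) + 1 := by
    rcases hval with ⟨h1, h2⟩ | ⟨h1, h2⟩
    · have hu := hlt u a (h1 ▸ hkn)
      have hw := hlt w b (h2 ▸ hln)
      have h1' : (k : ℤ) = 2 ^ u * (2 * (a : ℤ) + 1) := by exact_mod_cast h1
      have h2' : (l : ℤ) = 2 ^ w * (2 * (b : ℤ) + 1) := by exact_mod_cast h2
      rcases Nat.lt_or_gt_of_ne huw with hlt' | hlt'
      · exact exists_latinSquare_of_lt hlt' hw h1' h2' (Or.inl ⟨rfl, rfl⟩) o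
      · exact exists_latinSquare_of_gt hlt' hu h2' h1' (Or.inr ⟨rfl, rfl⟩) o
    · have hw := hlt w a (h1 ▸ hkn)
      have hu := hlt u b (h2 ▸ hln)
      have h1' : (k : ℤ) = 2 ^ w * (2 * (a : ℤ) + 1) := by exact_mod_cast h1
      have h2' : (l : ℤ) = 2 ^ u * (2 * (b : ℤ) + 1) := by exact_mod_cast h2
      rcases Nat.lt_or_gt_of_ne huw with hlt' | hlt'
      · exact exists_latinSquare_of_gt hlt' hw h2' h1' (Or.inl ⟨rfl, rfl⟩) o
      · exact exists_latinSquare_of_lt hlt' hu h1' h2' (Or.inr ⟨rfl, rfl⟩) o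
  obtain ⟨f, hf, hfill⟩ := hex
  refine ⟨f, hf, ?_⟩
  have hHH := natCast_half_add_half (n := n)
  push_cast at hHH ho hfill
  rintro ⟨t, i⟩ p hp
  cases t
  · simp only [cellPair, Bool.false_eq_true, if_false, Finset.mem_insert,
      Finset.mem_singleton] at hp
    push_cast at hp
    rcases hp with rfl | rfl
    · have := (hfill i).1
      rw [show i + o = i - 2 ^ n + l - h by rw [ho]; ring] at this
      simpa [vertexColor] using this
    · have := (hfill (i - k)).2.1
      rw [show i - k + (o + k - l) = i + 2 ^ n - h by rw [ho]; linear_combination -hHH,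
        sub_add_cancel] at this
      simpa [vertexColor] using this
  · simp only [cellPair, if_true, Finset.mem_insert, Finset.mem_singleton] at hp
    rcases hp with rfl | rfl
    · have := (hfill i).2.2.1
      rw [show i + (o - l + 2 ^ n) = i - h by rw [ho]; ring] at this
      simpa [vertexColor] using this
    · have := (hfill (i - k)).2.2.2
      rw [show i - k + (o + k + 2 ^ n) = i + l - h by rw [ho]; ring, sub_add_cancel] at this
      simpa [vertexColor] using this

/-! ### Assembly of the two cases -/

theorem two_pow_mul_odd_injective {u w a b : ℕ} (huw : u < w) :
    2 ^ u * (2 * a + 1) ≠ 2 ^ w * (2 * b + 1) := by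
  obtain ⟨d, rfl⟩ : ∃ d, w = u + 1 + d := ⟨w - u - 1, by omega⟩
  intro h
  rw [show 2 ^ (u + 1 + d) * (2 * b + 1) = 2 ^ u * (2 * (2 ^ d * (2 * b + 1))) by ring] at h
  have := Nat.eq_of_mul_eq_mul_left (by positivity) h
  omega

/-- The vital graph, its colouring by two binary digits and the completion, for `k` and `l` of
distinct 2-adic valuations. -/
theorem vital_of_valuations {n k l u w a b : ℕ} (hk : 1 ≤ k) (hkn : k < 2 ^ n) (hl : 1 ≤ l)
    (hln : l < 2 ^ n) (huw : u ≠ w)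
    (hval : k = 2 ^ u * (2 * a + 1) ∧ l = 2 ^ w * (2 * b + 1) ∨
      k = 2 ^ w * (2 * a + 1) ∧ l = 2 ^ u * (2 * b + 1)) (e h : ℤ) (hh : 2 * h = k + e + l) :
    IsVitalLabelling (psk (2 ^ (n + 1))) (fadeState (2 ^ (n + 1)) k l e) (2 * 2 ^ (n + 1))
      (pskConstraint (2 ^ (n + 1)) e k l) ∧
    ∃ κ : (vitalGraph (psk (2 ^ (n + 1))) (fadeState (2 ^ (n + 1)) k l e)).Coloring (Fin 8),
      HasColorClasses κ (2 * 2 ^ (n + 1)) (pskConstraint (2 ^ (n + 1)) e k l)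
        (digitClass (n + 1) u w) ∧
      Completable (2 ^ (n + 1)) (partialSquare κ) := by
  have hkl : k ≠ l := by
    rcases hval with ⟨rfl, rfl⟩ | ⟨rfl, rfl⟩ <;> rcases Nat.lt_or_gt_of_ne huw with h | h
    · exact two_pow_mul_odd_injective h
    · exact (two_pow_mul_odd_injective h).symm
    · exact (two_pow_mul_odd_injective h).symm
    · exact two_pow_mul_odd_injective h
  obtain ⟨f, hf, hfC⟩ := exists_latinSquare_cellPair hkn hln huw hval (h : ZMod (2 ^ (n + 1)))
  exact vital_conclusion (cellPair (k : ZMod (2 ^ (n + 1))) l (2 ^ n : ℕ) h)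
    (collision_iff rfl hk hkn.le hl hln.le hkl e h hh)
    (cellPair_disjoint hk hkn hl hln hkl h) (two_le_card_cellPair hk hkn h)
    (labelIndex (2 ^ (n + 1))) (bijOn_labelIndex _) _
    (fun v hv => pskConstraint_eq_cellPair e h hh hv) (vertexColor u w) f hf hfC _
    (fun v hv q => vertexColor_labelIndex_iff hv q)

theorem fadeState_zero (M k l : ℕ) : fadeState M k l 0 = fadeEven M k l := by
  simp [fadeState, unitRoot]

theorem fadeState_one (M k l : ℕ) : fadeState M k l 1 = fadeMixed M k l := by
  simp [fadeState, fadeMixed, unitRoot]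

theorem mainTheorem4 (lam : ℕ) (hlam : 3 ≤ lam) (M : ℕ) [NeZero M] (hM : M = 2 ^ lam) (k l : ℕ)
    (hk : k ∈ Set.Icc 1 (M / 2)) (hl : l ∈ Set.Icc 1 (M / 2)) (hk2 : k ≠ M / 2) (hl2 : l ≠ M / 2) :
    (∀ m₁ m₂ a₁ a₂ : ℕ, 1 ≤ m₁ → m₁ < m₂ → Odd a₁ → Odd a₂ → k = 2 ^ m₁ * a₁ → l = 2 ^ m₂ * a₂ →
      IsVitalLabelling (psk M) (fadeEven M k l) (2 * M) (pskConstraint M 0 k l) ∧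
      ∃ κ : (vitalGraph (psk M) (fadeEven M k l)).Coloring (Fin 8),
        HasColorClasses κ (2 * M) (pskConstraint M 0 k l) (evenClasses lam m₁ m₂) ∧
        Completable M (partialSquare κ)) ∧
    (∀ m a : ℕ, 1 ≤ m → Odd a → (Odd k ∧ l = 2 ^ m * a ∨ Odd l ∧ k = 2 ^ m * a) →
      IsVitalLabelling (psk M) (fadeMixed M k l) (2 * M) (pskConstraint M 1 k l) ∧
      ∃ κ : (vitalGraph (psk M) (fadeMixed M k l)).Coloring (Fin 8),
        HasColorClasses κ (2 * M) (pskConstraint M 1 k l) (mixedClasses lam m) ∧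
        Completable M (partialSquare κ)) := by
  obtain ⟨n, rfl⟩ : ∃ n, lam = n + 1 := ⟨lam - 1, by omega⟩
  subst hM
  have hhalf : 2 ^ (n + 1) / 2 = 2 ^ n := by rw [pow_succ, Nat.mul_div_cancel _ (by omega)]
  rw [hhalf] at hk hl hk2 hl2
  have hkn : k < 2 ^ n := lt_of_le_of_ne hk.2 hk2
  have hln : l < 2 ^ n := lt_of_le_of_ne hl.2 hl2
  have hlt (r c : ℕ) (hc : 2 ^ r * (2 * c + 1) < 2 ^ n) : r < n + 1 := by
    have := (Nat.pow_lt_pow_iff_right (a := 2) (by omega)).1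
      (lt_of_le_of_lt (Nat.le_mul_of_pos_right (2 ^ r) (by omega : 0 < 2 * c + 1)) hc)
    omega
  constructor
  · rintro m₁ m₂ _ _ hm₁ h12 ⟨a₁, rfl⟩ ⟨a₂, rfl⟩ hka hla
    rw [evenClasses_eq h12 (hlt m₂ a₂ (hla ▸ hln)), ← fadeState_zero]
    have hke : 2 ∣ k := hka ▸ (dvd_pow_self 2 (by omega)).mul_right _
    have hle : 2 ∣ l := hla ▸ (dvd_pow_self 2 (by omega)).mul_right _
    exact vital_of_valuations hk.1 hkn hl.1 hln h12.ne (Or.inl ⟨hka, hla⟩) 0 ((k + 0 + l) / 2)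
      (by omega)
  · rintro m _ hm ⟨a, rfl⟩ hor
    -- The odd parameter has valuation 0, so the digit positions are u = m and w = 0; here u > w,
    -- unlike in the even case.
    rcases hor with ⟨⟨c, hc⟩, hla⟩ | ⟨⟨c, hc⟩, hka⟩
    · have hle : 2 ∣ l := hla ▸ (dvd_pow_self 2 (by omega)).mul_right _
      rw [mixedClasses_eq hm (hlt m a (hla ▸ hln)), ← fadeState_one]
      exact vital_of_valuations (a := c) (b := a) hk.1 hkn hl.1 hln (by omega : m ≠ 0)
        (Or.inr ⟨by rw [hc]; ring, hla⟩) 1 ((k + 1 + l) / 2) (by omega)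
    · have hke : 2 ∣ k := hka ▸ (dvd_pow_self 2 (by omega)).mul_right _
      rw [mixedClasses_eq hm (hlt m a (hka ▸ hkn)), ← fadeState_one]
      exact vital_of_valuations (a := a) (b := c) hk.1 hkn hl.1 hln (by omega : m ≠ 0)
        (Or.inl ⟨hka, by rw [hc]; ring⟩) 1 ((k + 1 + l) / 2) (by omega)
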